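/- Throughout, $q$ is a prime power and $\mathbb{F}_q$ is the field with $q$ elements. For subspaces $U,V\subseteq\mathbb{F}_q^n$ put $d_S(U,V)=\dim(U+V)-\dim(U\cap V)$. For a set $\mathcal{C}$ of subspaces of $\mathbb{F}_q^n$ let $\eta_i(\mathcal{C})=|\{X\in\mathcal{C}:\dim X=i\}|$. Let $A_q(n,d,\{k\})$ be the maximum size of a nonempty set of $k$-dimensional subspaces of $\mathbb{F}_q^n$ such that any two distinct members have subspace distance at least $d$. For positive integers $d_1\ge d_0$, an $(n,d_1,d_0,T)_q$ mixed dimension/distance subspace code (MDDC) is a set $\mathcal{C}$ of subspaces of $\mathbb{F}_q^n$ such that, for distinct $X,Y\in\mathcal{C}$, $d_S(X,Y)\ge d_1$ if $\dim X=\dim Y$ and $d_S(X,Y)\ge d_0$ if $\dim X\ne\dim Y$, and such that $\eta_i(\mathcal{C})>0$ for $i\in T$ and $\eta_i(\mathcal{C})=0$ for $i\notin T$. For a nonempty finite set $T$ of integers let $T^{\min}$ be its minimum, and let $l_T=\min\{u-v:u,v\in T,\ u>v\}$ if $|T|>1$ and $l_T=0$ if $|T|=1$. Put $$\begin{bmatrix}n\\k\end{bmatrix}_q=\prod_{i=0}^{k-1}\frac{q^n-q^i}{q^k-q^i},\qquad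 \Delta(m,n,d)_q=q^{\max\{m,n\}(\min\{m,n\}-d+1)},$$ $$D(m,n,d,i)_q=\begin{bmatrix}\min\{m,n\}\\i\end{bmatrix}_q\sum_{j=0}^{i-d}(-1)^jq^{\frac{j(j-1)}{2}}\begin{bmatrix}i\\j\end{bmatrix}_q\left(q^{\max\{m,n\}(i-d-j+1)}-1\right),$$ $$\Delta(m,n,d;r)_q=1+\sum_{i=d}^{r}D(m,n,d,i)_q.$$ **Theorem.** Let $n,n_1,n_2,k,\delta$ be nonnegative integers with $n=n_1+n_2$, $k\ge 2\delta$, and $n_i\ge k$ for $i=1,2$. Let $T_1\subseteq[\delta,k]$ be a nonempty set of integers with $l_{T_1}<2\delta$, and let $T_2\subseteq[k+\delta-T_1^{\min},k]$ be a nonempty set of integers with $l_{T_2}<2\delta$. (In particular $\delta\ge 1$.) Let $n_3$ be a positive integer with $n_1+k-T_1^{\min}\le n-n_3+T_2^{\min}-k$. Put $\mu_1=n_1+k-T_1^{\min}$, $\mu_2=n_3+k-T_2^{\min}$, $\mu_3=n-\mu_1-\mu_2$; let $\omega_1=k-\delta$ if $\mu_1>\mu_2$ and $\omega_1=\delta$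 otherwise, and $\omega_2=k-\omega_1$. Put $$\theta_1=\left\lfloor\frac{\mu_1-\omega_1}{\delta}\right\rfloor-1,\qquad \theta_2=\min\left\{\left\lfloor\frac{\mu_2-\omega_2}{\delta}\right\rfloor,\left\lfloor\frac{\mu_2+\mu_3-\omega_2}{\delta}\right\rfloor-1\right\}.$$ For $0\le i\le\theta_1$ let $\Lambda_1^i=\max\{\omega_1,\mu_1-\omega_1-i\delta\}$ and $\Gamma_1^i=\min\{\omega_1,\mu_1-\omega_1-i\delta\}$; for $0\le j\le\theta_2$ let $\Lambda_3^j=\max\{\omega_2,\mu_2+\mu_3-\omega_2-j\delta\}$ and $\Gamma_3^j=\min\{\omega_2,\mu_2+\mu_3-\omega_2-j\delta\}$. For these $i,j$ let $d_1^{(i,j)}=\lceil\delta/2\rceil$ if $\Lambda_1^i\ge\Lambda_3^j$ and $d_1^{(i,j)}=\lfloor\delta/2\rfloor$ otherwise, and let $d_2^{(i,j)}=\delta-d_1^{(i,j)}$. If $\mathcal{X}_1$ is an $(n_1,2\delta,2\delta-l_{T_1},T_1)_q$ MDDC and $\mathcal{X}_3$ is an $(n_3,2\delta,2\delta-l_{T_2},T_2)_q$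 MDDC, then $$\begin{aligned}A_q(n,2\delta,\{k\})\ \ge\ &\sum_{t\in T_1}\eta_t(\mathcal{X}_1)\,\Delta(k,n_2+t-k,\delta)_q+\sum_{s\in T_2}\eta_s(\mathcal{X}_3)\,\Delta(k,n-n_3+s-k,\delta;k-\delta)_q\\&+\Delta(\omega_1,n_2-2k+T_1^{\min}+\omega_1,\delta;\omega_1-\delta)_q\cdot\sum_{i=0}^{\theta_1}\sum_{j=0}^{\theta_2}q^{\min\{\Lambda_1^id_2^{(i,j)},\,\Lambda_3^jd_1^{(i,j)}\}+\Lambda_1^i(\Gamma_1^i-\delta+1)+\Lambda_3^j(\Gamma_3^j-\delta+1)}.\end{aligned}$$ -/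

import Mathlib

/-- The subspace distance `dim (U + V) - dim (U ∩ V)`. -/
noncomputable def subspaceDist {F : Type*} [Field F] {n : ℕ}
    (U V : Submodule F (Fin n → F)) : ℕ :=
  Module.finrank F (U ⊔ V : Submodule F (Fin n → F)) -
    Module.finrank F (U ⊓ V : Submodule F (Fin n → F))

/-- The dimension distribution `η_i(C)`: the number of codewords of dimension `i`. -/
noncomputable def dimDistr {F : Type*} [Field F] {n : ℕ}
    (C : Set (Submodule F (Fin n → F))) (i : ℕ) : ℕ :=
  {U ∈ C | Module.finrank F U = i}.ncard

/-- `C` is an `(n, d, T)_q` subspace code. -/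
def IsSubspaceCode {F : Type*} [Field F] {n : ℕ} (d : ℕ) (T : Finset ℕ)
    (C : Set (Submodule F (Fin n → F))) : Prop :=
  C.Nonempty ∧ (∀ U ∈ C, ∀ V ∈ C, U ≠ V → d ≤ subspaceDist U V) ∧
    (∀ i ∈ T, 0 < dimDistr C i) ∧ (∀ i, i ∉ T → dimDistr C i = 0)

/-- `A_q(n, d, {k})`, where `q` is the number of elements of `F`: the maximum size of an
`(n, d, {k})_q` constant dimension code. -/
noncomputable def maxCDCSize (F : Type*) [Field F] (n d k : ℕ) : ℕ :=
  sSup {M : ℕ | ∃ C : Set (Submodule F (Fin n → F)), IsSubspaceCode d {k} C ∧ C.ncard = M}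

/-- Over a finite field and for `k ≤ n` the supremum defining `maxCDCSize` is a maximum. -/
theorem isGreatest_maxCDCSize (F : Type*) [Field F] [Fintype F] (n d k : ℕ) (hk : k ≤ n) :
    IsGreatest {M : ℕ | ∃ C : Set (Submodule F (Fin n → F)),
      IsSubspaceCode d {k} C ∧ C.ncard = M} (maxCDCSize F n d k) := by
  have hfin : Finite (Submodule F (Fin n → F)) :=
    Finite.of_injective (fun U : Submodule F (Fin n → F) => (U : Set (Fin n → F)))
      SetLike.coe_injective
  have hne : {M : ℕ | ∃ C : Set (Submodule F (Fin n → F)),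
      IsSubspaceCode d {k} C ∧ C.ncard = M}.Nonempty := by
    obtain ⟨W, hW⟩ : ∃ W : Submodule F (Fin n → F), Module.finrank F W = k := by
      let b : Fin k → (Fin n → F) := fun i => Pi.basisFun F (Fin n) (Fin.castLE hk i)
      have hb : LinearIndependent F b :=
        (Pi.basisFun F (Fin n)).linearIndependent.comp _ (Fin.castLE_injective hk)
      exact ⟨Submodule.span F (Set.range b), by simpa using finrank_span_eq_card hb⟩
    refine ⟨_, {W}, ⟨⟨W, rfl⟩, ?_, ?_, ?_⟩, rfl⟩
    · rintro U rfl V rfl h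
      exact absurd rfl h
    · intro i hi
      rw [Finset.mem_singleton] at hi
      subst hi
      exact (Set.ncard_pos (Set.toFinite _)).2 ⟨W, rfl, hW⟩
    · intro i hi
      rw [Finset.mem_singleton] at hi
      refine (Set.ncard_eq_zero (Set.toFinite _)).2 (Set.eq_empty_iff_forall_notMem.2 ?_)
      rintro U ⟨rfl, hU⟩
      exact hi (hU.symm.trans hW)
  have hbdd : BddAbove {M : ℕ | ∃ C : Set (Submodule F (Fin n → F)),
      IsSubspaceCode d {k} C ∧ C.ncard = M} := by
    refine ⟨(Set.univ : Set (Submodule F (Fin n → F))).ncard, ?_⟩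
    rintro M ⟨C, -, rfl⟩
    exact Set.ncard_le_ncard (Set.subset_univ C) (Set.toFinite _)
  exact ⟨Nat.sSup_mem hne hbdd, fun M hM => le_csSup hbdd hM⟩

/-- `C` is an `(n, d₁, d₀, T)_q` mixed dimension/distance subspace code (MDDC). -/
def IsMDDC {F : Type*} [Field F] {n : ℕ} (d₁ d₀ : ℕ) (T : Finset ℕ)
    (C : Set (Submodule F (Fin n → F))) : Prop :=
  0 < d₀ ∧ d₀ ≤ d₁ ∧
    (∀ U ∈ C, ∀ V ∈ C, U ≠ V → Module.finrank F U = Module.finrank F V →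
      d₁ ≤ subspaceDist U V) ∧
    (∀ U ∈ C, ∀ V ∈ C, Module.finrank F U ≠ Module.finrank F V →
      d₀ ≤ subspaceDist U V) ∧
    (∀ i ∈ T, 0 < dimDistr C i) ∧ (∀ i, i ∉ T → dimDistr C i = 0)

/-- `l_T`: the smallest difference `u - v` of elements `u > v` of `T` if `T` has more than one
element, and `0` otherwise. -/
noncomputable def minGap (T : Finset ℕ) : ℕ :=
  if 1 < T.card then sInf {d : ℕ | ∃ u ∈ T, ∃ v ∈ T, v < u ∧ d = u - v} else 0

/-- The Gaussian binomial coefficient `[n, k]_q`. -/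
def gaussBinom (q n k : ℕ) : ℚ :=
  ∏ i ∈ Finset.range k, ((q : ℚ) ^ n - (q : ℚ) ^ i) / ((q : ℚ) ^ k - (q : ℚ) ^ i)

/-- `Δ(m, n, d)_q = q ^ (max{m,n} (min{m,n} - d + 1))`, the Singleton-like bound
(used for `d ≤ min{m,n}`). -/
def mrdSize (q m n d : ℕ) : ℕ :=
  q ^ (max m n * (min m n + 1 - d))

/-- `D(m, n, d, i)_q`, the number of matrices of rank `i` in a linear `m × n` MRD code of minimum
rank distance `d` (used for `1 ≤ d ≤ i ≤ min{m,n}`), by Delsarte's formula. -/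
def rankDistr (q m n d i : ℕ) : ℚ :=
  gaussBinom q (min m n) i *
    ∑ j ∈ Finset.range (i - d + 1),
      (-1 : ℚ) ^ j * (q : ℚ) ^ (j * (j - 1) / 2) * gaussBinom q i j *
        ((q : ℚ) ^ (max m n * (i - d - j + 1)) - 1)

/-- `Δ(m, n, d; r)_q = 1 + ∑_{i=d}^{r} D(m, n, d, i)_q`. -/
def rrmcSize (q m n d r : ℕ) : ℚ :=
  1 + ∑ i ∈ Finset.Icc d r, rankDistr q m n d i

/-! The code is a union of three families of `k`-dimensional subspaces in which any two distinct
words meet in dimension at most `k - δ`. The first family lifts the codewords `U` of `X₁` to row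
spaces of `(U, I | M)` with `M` in an MRD code. The second lifts those of `X₃` from the right-hand
end of the coordinates, with `M` in an MRD code cut down to rank at most `k - δ`. Within both
(`exists_lifted_family`), distinct `M` over one `U` are separated by rank distance, and distinct `U`
by the MDDC distance after projection onto the coordinates of `U`; the relaxed distance `2δ - l_T`
suffices for unequal dimensions because the dimension gap compensates.

The third family (`exists_block_family`) splits the coordinates into the first `μ₁` and the rest,
and combines row spaces of `(0 | I | M₁)` and `(0 | I | M₃)`. Blocks with different zero offsets,
which are multiples of `δ`, are separated by the offset (`finrank_range_blockMap_inf_add_le_of_lt`).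
For fixed offsets the pairs `(M₁, M₃)` run over products of equally labelled cosets of distance-`δ`
codes: labels are separated by `d₁` on the left plus `d₂ = δ - d₁` on the right
(`exists_coset_labels`). A rank restricted code then glues the two halves (`exists_paired_family`).

Different families are separated by two coordinate subspaces: `K₁`, vanishing on the first `μ₁`
coordinates, and `K₂`, vanishing on the last `μ₂`. A word meeting `K` trivially and a word meeting
`K` in dimension at least `δ` intersect in codimension at least `δ`
(`finrank_inf_add_le_of_inf_eq_bot`). The first family avoids `K₁` while the other two meet it in
dimension at least `δ`; the second avoids `K₂` while the third meets it in dimension at least `δ`.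

Counting requires MRD codes of every size (`exists_mrd`, Gabidulin codes) and Delsarte's rank
distribution (`card_filter_finrank_range_of_mrd`), obtained by Gaussian inversion from the number of
codewords vanishing on a given subspace. -/

/-! ### Gaussian binomials and their inversion formula. -/

section GaussBinom

/-- The product `(q - 1)(q² - 1)⋯(qⁿ - 1)`, the analogue of the factorial for Gaussian binomials. -/
def qPochhammer (q n : ℕ) : ℚ := ∏ i ∈ Finset.range n, ((q : ℚ) ^ (i + 1) - 1)

theorem qPochhammer_succ (q n : ℕ) :
    qPochhammer q (n + 1) = qPochhammer q n * ((q : ℚ) ^ (n + 1) - 1) :=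
  Finset.prod_range_succ _ _

theorem cast_pow_sub_one_ne_zero {q : ℕ} (hq : 2 ≤ q) (n : ℕ) : (q : ℚ) ^ (n + 1) - 1 ≠ 0 := by
  have h : (1 : ℚ) < (q : ℚ) ^ (n + 1) :=
    one_lt_pow₀ (by exact_mod_cast hq) (Nat.succ_ne_zero n)
  exact (sub_pos.2 h).ne'

theorem qPochhammer_ne_zero {q : ℕ} (hq : 2 ≤ q) (n : ℕ) : qPochhammer q n ≠ 0 :=
  Finset.prod_ne_zero_iff.2 fun i _ => cast_pow_sub_one_ne_zero hq i

theorem prod_pow_sub_pow_mul_qPochhammer (q n k : ℕ) (hk : k ≤ n) :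
    (∏ i ∈ Finset.range k, ((q : ℚ) ^ n - (q : ℚ) ^ i)) * qPochhammer q (n - k) =
      (∏ i ∈ Finset.range k, (q : ℚ) ^ i) * qPochhammer q n := by
  induction k with
  | zero => simp
  | succ k ih =>
    obtain ⟨m, rfl⟩ := Nat.exists_eq_add_of_le hk
    have h1 : k + 1 + m - k = m + 1 := by omega
    have h2 : k + 1 + m - (k + 1) = m := by omega
    have := ih (by omega)
    rw [h1, qPochhammer_succ] at this
    rw [Finset.prod_range_succ, Finset.prod_range_succ, h2]
    have h3 : (q : ℚ) ^ (k + 1 + m) - (q : ℚ) ^ k = (q : ℚ) ^ k * ((q : ℚ) ^ (m + 1) - 1) := by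
      ring
    rw [h3]
    linear_combination (q : ℚ) ^ k * this

theorem prod_pow_self_sub_pow_ne_zero {q : ℕ} (hq : 2 ≤ q) (k : ℕ) :
    ∏ i ∈ Finset.range k, ((q : ℚ) ^ k - (q : ℚ) ^ i) ≠ 0 := by
  refine Finset.prod_ne_zero_iff.2 fun i hi => (sub_pos.2 ?_).ne'
  exact pow_lt_pow_right₀ (by exact_mod_cast hq) (Finset.mem_range.1 hi)

theorem gaussBinom_eq_div {q : ℕ} (hq : 2 ≤ q) {n k : ℕ} (hk : k ≤ n) :
    gaussBinom q n k = qPochhammer q n / (qPochhammer q k * qPochhammer q (n - k)) := by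
  have h1 := prod_pow_sub_pow_mul_qPochhammer q n k hk
  have h2 := prod_pow_sub_pow_mul_qPochhammer q k k le_rfl
  have h3 : qPochhammer q (k - k) = 1 := by simp [qPochhammer]
  have h4 := prod_pow_self_sub_pow_ne_zero hq k
  have h5 := qPochhammer_ne_zero hq k
  have h6 := qPochhammer_ne_zero hq (n - k)
  rw [h3, mul_one] at h2
  rw [gaussBinom, Finset.prod_div_distrib, div_eq_div_iff h4 (mul_ne_zero h5 h6)]
  rw [h2]
  linear_combination qPochhammer q k * h1

theorem gaussBinom_eq_zero {q n k : ℕ} (h : n < k) : gaussBinom q n k = 0 :=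
  Finset.prod_eq_zero (Finset.mem_range.2 h) (by simp)

theorem gaussBinom_self {q : ℕ} (hq : 2 ≤ q) (n : ℕ) : gaussBinom q n n = 1 := by
  rw [gaussBinom, Finset.prod_div_distrib, div_self (prod_pow_self_sub_pow_ne_zero hq n)]

theorem gaussBinom_zero_right (q n : ℕ) : gaussBinom q n 0 = 1 := by simp [gaussBinom]

theorem gaussBinom_succ_succ {q : ℕ} (hq : 2 ≤ q) (m j : ℕ) :
    gaussBinom q (m + 1) (j + 1) =
      (q : ℚ) ^ (j + 1) * gaussBinom q m (j + 1) + gaussBinom q m j := by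
  rcases lt_trichotomy m j with h | rfl | h
  · simp [gaussBinom_eq_zero h, gaussBinom_eq_zero (Nat.succ_lt_succ h),
      gaussBinom_eq_zero (Nat.lt_succ_of_lt h)]
  · simp [gaussBinom_self hq, gaussBinom_eq_zero (Nat.lt_succ_self m)]
  · obtain ⟨r, rfl⟩ := Nat.exists_eq_add_of_lt h
    rw [gaussBinom_eq_div hq (by omega : j + 1 ≤ j + r + 1 + 1),
      gaussBinom_eq_div hq (by omega : j + 1 ≤ j + r + 1),
      gaussBinom_eq_div hq (by omega : j ≤ j + r + 1)]
    have e1 : j + r + 1 + 1 - (j + 1) = r + 1 := by omega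
    have e2 : j + r + 1 - (j + 1) = r := by omega
    have e3 : j + r + 1 - j = r + 1 := by omega
    have h1 := qPochhammer_ne_zero hq j
    have h2 := qPochhammer_ne_zero hq r
    have h3 := cast_pow_sub_one_ne_zero hq j
    have h4 := cast_pow_sub_one_ne_zero hq r
    rw [e1, e2, e3, qPochhammer_succ q (j + r + 1), qPochhammer_succ q j, qPochhammer_succ q r]
    field_simp
    ring

/-- Multiplication rule for Gaussian binomials. -/
theorem gaussBinom_mul_gaussBinom {q : ℕ} (hq : 2 ≤ q) (w e j : ℕ) :
    gaussBinom q (e + j) j * gaussBinom q w (e + j) =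
      gaussBinom q w e * gaussBinom q (w - e) j := by
  rcases lt_or_ge w e with h | h
  · rw [gaussBinom_eq_zero h, gaussBinom_eq_zero (by omega : w < e + j)]
    simp
  obtain ⟨m, rfl⟩ := Nat.exists_eq_add_of_le h
  have e0 : e + m - e = m := by omega
  rw [e0]
  rcases lt_or_ge m j with h' | h'
  · rw [gaussBinom_eq_zero h', gaussBinom_eq_zero (by omega : e + m < e + j)]
    simp
  obtain ⟨r, rfl⟩ := Nat.exists_eq_add_of_le h'
  rw [gaussBinom_eq_div hq (by omega : j ≤ e + j),
    gaussBinom_eq_div hq (by omega : e + j ≤ e + (j + r)),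
    gaussBinom_eq_div hq (by omega : e ≤ e + (j + r)),
    gaussBinom_eq_div hq (by omega : j ≤ j + r)]
  have e1 : e + j - j = e := by omega
  have e2 : e + (j + r) - (e + j) = r := by omega
  have e3 : j + r - j = r := by omega
  have e4 : e + (j + r) - e = j + r := by omega
  rw [e1, e2, e3, e4]
  have h1 := qPochhammer_ne_zero hq j
  have h2 := qPochhammer_ne_zero hq r
  have h3 := qPochhammer_ne_zero hq e
  have h4 := qPochhammer_ne_zero hq (e + j)
  have h5 := qPochhammer_ne_zero hq (j + r)
  field_simp

/-- The partial alternating sums of Gaussian binomials. -/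
theorem sum_alternating_gaussBinom_succ {q : ℕ} (hq : 2 ≤ q) (m J : ℕ) :
    ∑ j ∈ Finset.range (J + 1),
      (-1 : ℚ) ^ j * (q : ℚ) ^ (j * (j - 1) / 2) * gaussBinom q (m + 1) j =
      (-1 : ℚ) ^ J * (q : ℚ) ^ ((J + 1) * J / 2) * gaussBinom q m J := by
  induction J with
  | zero => simp [gaussBinom_zero_right]
  | succ J ih =>
    rw [Finset.sum_range_succ, ih, gaussBinom_succ_succ hq]
    have e1 : (J + 1) * (J + 1 - 1) / 2 = (J + 1) * J / 2 := by simp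
    have e2 : (J + 1 + 1) * (J + 1) / 2 = (J + 1) * J / 2 + (J + 1) := by
      have : (J + 1 + 1) * (J + 1) = (J + 1) * J + (J + 1) * 2 := by ring
      rw [this, Nat.add_mul_div_right _ _ (by norm_num)]
    rw [e1, e2]
    ring

theorem sum_alternating_gaussBinom {q : ℕ} (hq : 2 ≤ q) {m J : ℕ} (h : m ≤ J) :
    ∑ j ∈ Finset.range (J + 1),
      (-1 : ℚ) ^ j * (q : ℚ) ^ (j * (j - 1) / 2) * gaussBinom q m j =
      if m = 0 then 1 else 0 := by
  rcases m with _ | m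
  · rw [Finset.sum_range_succ', Finset.sum_eq_zero]
    · simp [gaussBinom_zero_right]
    · intro j _
      rw [gaussBinom_eq_zero (Nat.succ_pos j), mul_zero]
  · rw [sum_alternating_gaussBinom_succ hq, gaussBinom_eq_zero (by omega : m < J)]
    simp

/-- Gaussian binomial inversion at a single nullity. -/
theorem sum_alternating_gaussBinom_mul {q : ℕ} (hq : 2 ≤ q) {w e i : ℕ} (h : w ≤ e + i) :
    ∑ j ∈ Finset.range (i + 1),
      (-1 : ℚ) ^ j * (q : ℚ) ^ (j * (j - 1) / 2) * gaussBinom q (e + j) j *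
        gaussBinom q w (e + j) = if w = e then 1 else 0 := by
  have : ∀ j, (-1 : ℚ) ^ j * (q : ℚ) ^ (j * (j - 1) / 2) * gaussBinom q (e + j) j *
        gaussBinom q w (e + j) = gaussBinom q w e *
        ((-1 : ℚ) ^ j * (q : ℚ) ^ (j * (j - 1) / 2) * gaussBinom q (w - e) j) := by
    intro j
    linear_combination (-1 : ℚ) ^ j * (q : ℚ) ^ (j * (j - 1) / 2) *
      gaussBinom_mul_gaussBinom hq w e j
  simp_rw [this]
  rw [← Finset.mul_sum, sum_alternating_gaussBinom hq (by omega : w - e ≤ i)]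
  rcases lt_trichotomy w e with h' | rfl | h'
  · rw [gaussBinom_eq_zero h', if_neg h'.ne, zero_mul]
  · simp [gaussBinom_self hq]
  · rw [if_neg (by omega), if_neg h'.ne', mul_zero]

/-- Both sides equal the same q-multinomial coefficient with parts `j`, `i - j`, `a - i`. This
passes from the inversion formula, indexed by nullity, to Delsarte's formula, indexed by rank. -/
theorem gaussBinom_mul_gaussBinom_sub {q : ℕ} (hq : 2 ≤ q) {a i j : ℕ} (hi : i ≤ a) (hj : j ≤ i) :
    gaussBinom q a i * gaussBinom q i j =
      gaussBinom q (a - i + j) j * gaussBinom q a (a - i + j) := by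
  obtain ⟨s, rfl⟩ := Nat.exists_eq_add_of_le hi
  obtain ⟨r, rfl⟩ := Nat.exists_eq_add_of_le hj
  have e1 : j + r + s - (j + r) = s := by omega
  have e2 : j + r + s - (s + j) = r := by omega
  have e3 : s + j - j = s := by omega
  have e4 : j + r - j = r := by omega
  rw [e1, gaussBinom_eq_div hq (by omega : j + r ≤ j + r + s),
    gaussBinom_eq_div hq (by omega : j ≤ j + r),
    gaussBinom_eq_div hq (by omega : j ≤ s + j),
    gaussBinom_eq_div hq (by omega : s + j ≤ j + r + s), e1, e2, e3, e4]
  have h1 := qPochhammer_ne_zero hq j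
  have h2 := qPochhammer_ne_zero hq r
  have h3 := qPochhammer_ne_zero hq s
  have h4 := qPochhammer_ne_zero hq (j + r)
  have h5 := qPochhammer_ne_zero hq (s + j)
  field_simp

end GaussBinom

/-! ### Rank distribution of additive MRD codes. -/

section RankDistribution

open Module

variable {F : Type*} [Field F]

/-- A submodule of given dimension inside a given submodule. -/
theorem exists_le_finrank_eq {E : Type*} [AddCommGroup E] [Module F E] [FiniteDimensional F E]
    (P : Submodule F E) {d : ℕ} (hd : d ≤ finrank F P) :
    ∃ Q : Submodule F E, Q ≤ P ∧ finrank F Q = d := by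
  let v : Fin d → E := fun i => (finBasis F P (Fin.castLE hd i) : E)
  have hv : LinearIndependent F v :=
    (((finBasis F P).linearIndependent.comp _ (Fin.castLE_injective hd))).map' P.subtype
      P.ker_subtype
  refine ⟨Submodule.span F (Set.range v), Submodule.span_le.2 ?_, ?_⟩
  · rintro _ ⟨i, rfl⟩
    exact (finBasis F P (Fin.castLE hd i)).2
  · rw [finrank_span_eq_card hv, Fintype.card_fin]

theorem finrank_ker_le_of_le_finrank_range {E Y : Type*} [AddCommGroup E] [Module F E]
    [FiniteDimensional F E] [AddCommGroup Y] [Module F Y] {A : E →ₗ[F] Y} {d : ℕ}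
    (h : d ≤ finrank F (LinearMap.range A)) :
    finrank F (LinearMap.ker A) + d ≤ finrank F E := by
  have := A.finrank_range_add_finrank_ker
  omega

variable [Fintype F]

theorem natCard_linearIndependent_cast {V : Type*} [AddCommGroup V] [Module F V]
    [FiniteDimensional F V] (z : ℕ) :
    (Nat.card {s : Fin z → V // LinearIndependent F s} : ℚ) =
      ∏ i ∈ Finset.range z, ((Fintype.card F : ℚ) ^ finrank F V - (Fintype.card F : ℚ) ^ i) := by
  have : Finite V := Module.finite_of_finite F
  rcases le_or_gt z (finrank F V) with h | h
  · rw [card_linearIndependent h, ← Fin.prod_univ_eq_prod_range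
      (fun i => (Fintype.card F : ℚ) ^ finrank F V - (Fintype.card F : ℚ) ^ i), Nat.cast_prod]
    refine Finset.prod_congr rfl fun i _ => ?_
    rw [Nat.cast_sub (Nat.pow_le_pow_right Fintype.card_pos (i.2.le.trans h))]
    simp
  · rw [Finset.prod_eq_zero (Finset.mem_range.2 h) (by simp)]
    have : IsEmpty {s : Fin z → V // LinearIndependent F s} := by
      refine ⟨fun s => ?_⟩
      have := s.2.fintype_card_le_finrank
      rw [Fintype.card_fin] at this
      omega
    simp

variable {E Y : Type*} [AddCommGroup E] [Module F E] [FiniteDimensional F E]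
  [AddCommGroup Y] [Module F Y] [FiniteDimensional F Y]

theorem natCard_linearMap :
    Nat.card (E →ₗ[F] Y) = Fintype.card F ^ (finrank F E * finrank F Y) := by
  have : Finite (E →ₗ[F] Y) := Module.finite_of_finite F
  rw [Module.natCard_eq_pow_finrank (K := F), Module.finrank_linearMap, Nat.card_eq_fintype_card]

/-- In a code attaining the Singleton-like bound the number of maps vanishing on a given subspace
depends only on the dimension of the subspace. -/
theorem natCard_vanishing_of_mrd (C : AddSubgroup (E →ₗ[F] Y)) {d : ℕ} (hd : 1 ≤ d)
    (hda : d ≤ finrank F E)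
    (hcard : Nat.card C = Fintype.card F ^ (finrank F Y * (finrank F E + 1 - d)))
    (hrank : ∀ A ∈ C, A ≠ 0 → d ≤ finrank F (LinearMap.range A)) (Z : Submodule F E) :
    Nat.card {A : C // Z ≤ LinearMap.ker A.1} =
      Fintype.card F ^ (finrank F Y * (finrank F E + 1 - d - finrank F Z)) := by
  have hfin : Finite (E →ₗ[F] Y) := Module.finite_of_finite F
  have hzero : ∀ A ∈ C, ∀ P : Submodule F E, finrank F E + 1 - d ≤ finrank F P →
      P ≤ LinearMap.ker A → A = 0 := by
    intro A hA P hP hle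
    by_contra h0
    have h1 := finrank_ker_le_of_le_finrank_range (hrank A hA h0)
    have h2 := Submodule.finrank_mono hle
    omega
  rcases le_or_gt (finrank F E + 1 - d) (finrank F Z) with h | h
  · rw [Nat.sub_eq_zero_of_le h, mul_zero, pow_zero, Nat.card_eq_one_iff_unique]
    refine ⟨⟨fun A B => ?_⟩, ⟨⟨0, by simp⟩⟩⟩
    have hA := hzero A.1.1 A.1.2 Z h A.2
    have hB := hzero B.1.1 B.1.2 Z h B.2
    exact Subtype.ext (Subtype.ext (hA.trans hB.symm))
  · let f : C →+ (Z →ₗ[F] Y) :=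
      ((LinearMap.domRestrict' Z : (E →ₗ[F] Y) →ₗ[F] (Z →ₗ[F] Y)).toAddMonoidHom).comp C.subtype
    have hf : ∀ A : C, f A = 0 ↔ Z ≤ LinearMap.ker A.1 := by
      intro A
      constructor
      · intro hA x hx
        exact LinearMap.congr_fun hA ⟨x, hx⟩
      · intro hA
        ext x
        exact hA x.2
    have hker : Nat.card {A : C // Z ≤ LinearMap.ker A.1} = Nat.card f.ker :=
      Nat.card_congr (Equiv.subtypeEquivRight fun A => ((AddMonoidHom.mem_ker).trans (hf A)).symm)
    have hq : 0 < Fintype.card F := Fintype.card_pos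
    apply le_antisymm
    -- Upper bound: enlarge `Z` by an independent `P` to dimension `a + 1 - d`, with `a = finrank F
    -- E`. A codeword vanishing there has rank below `d`, hence is zero, so codewords vanishing on
    -- `Z` are determined by their restriction to `P`.
    · obtain ⟨Q, hQ⟩ := Submodule.exists_isCompl Z
      have hQr := Submodule.finrank_add_eq_of_isCompl hQ
      obtain ⟨P, hPQ, hP⟩ := exists_le_finrank_eq Q
        (d := finrank F E + 1 - d - finrank F Z) (by omega)
      have hdisj : Z ⊓ P = ⊥ := (hQ.disjoint.mono_right hPQ).eq_bot
      have hsup : finrank F (Z ⊔ P : Submodule F E) = finrank F E + 1 - d := by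
        have := Submodule.finrank_sup_add_finrank_inf_eq Z P
        rw [hdisj, finrank_bot] at this
        omega
      have hinj : Function.Injective (fun A : {A : C // Z ≤ LinearMap.ker A.1} =>
          A.1.1.domRestrict P) := by
        intro A B hAB
        have hsub : A.1.1 - B.1.1 = 0 := by
          refine hzero _ (C.sub_mem A.1.2 B.1.2) (Z ⊔ P) hsup.ge (sup_le ?_ ?_)
          · intro x hx
            rw [LinearMap.mem_ker, LinearMap.sub_apply, A.2 hx, B.2 hx, sub_zero]
          · intro x hx
            rw [LinearMap.mem_ker, LinearMap.sub_apply, sub_eq_zero]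
            exact LinearMap.congr_fun hAB ⟨x, hx⟩
        exact Subtype.ext (Subtype.ext (sub_eq_zero.1 hsub))
      have hfin' : Finite (P →ₗ[F] Y) := Module.finite_of_finite F
      refine (Nat.card_le_card_of_injective _ hinj).trans_eq ?_
      rw [natCard_linearMap, hP, mul_comm]
    -- Lower bound: the restrictions to `Z` take at most `q ^ (dim Z * dim Y)` values, so the kernel
    -- of restriction is at least the quotient of the code size by this number.
    · have h1 := f.ker.card_mul_index
      rw [AddSubgroup.index_ker, hcard] at h1
      have hfin' : Finite (Z →ₗ[F] Y) := Module.finite_of_finite F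
      have h2 : Nat.card f.range ≤ Nat.card (Z →ₗ[F] Y) :=
        Nat.card_le_card_of_injective _ Subtype.val_injective
      rw [natCard_linearMap] at h2
      rw [hker]
      have h3 : finrank F Y * (finrank F E + 1 - d) =
          finrank F Y * (finrank F E + 1 - d - finrank F Z) + finrank F Z * finrank F Y := by
        rw [mul_comm (finrank F Z), ← mul_add]
        congr 1
        omega
      rw [h3, pow_add] at h1
      refine Nat.le_of_mul_le_mul_right (c := Fintype.card F ^ (finrank F Z * finrank F Y)) ?_
        (pow_pos hq _)
      rw [← h1]
      exact Nat.mul_le_mul_left _ h2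

/-- Double counting of pairs of a map of the code and an independent tuple in its kernel. -/
theorem sum_gaussBinom_finrank_ker_of_mrd (C : AddSubgroup (E →ₗ[F] Y)) [Fintype C] {d : ℕ}
    (hd : 1 ≤ d) (hda : d ≤ finrank F E)
    (hcard : Nat.card C = Fintype.card F ^ (finrank F Y * (finrank F E + 1 - d)))
    (hrank : ∀ A ∈ C, A ≠ 0 → d ≤ finrank F (LinearMap.range A)) (z : ℕ) :
    ∑ A : C, gaussBinom (Fintype.card F) (finrank F (LinearMap.ker A.1)) z =
      gaussBinom (Fintype.card F) (finrank F E) z *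
        (Fintype.card F : ℚ) ^ (finrank F Y * (finrank F E + 1 - d - z)) := by
  classical
  have hfin : Finite (E →ₗ[F] Y) := Module.finite_of_finite F
  have hfinE : Finite E := Module.finite_of_finite F
  have hfinLI : Fintype {v : Fin z → E // LinearIndependent F v} := Fintype.ofFinite _
  let e : (Σ A : C, {v : Fin z → LinearMap.ker A.1 // LinearIndependent F v}) ≃
      (Σ v : {v : Fin z → E // LinearIndependent F v},
        {A : C // Submodule.span F (Set.range v.1) ≤ LinearMap.ker A.1}) :=
    { toFun := fun p => ⟨⟨fun i => (p.2.1 i : E),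
          p.2.2.map' (LinearMap.ker p.1.1).subtype (Submodule.ker_subtype _)⟩,
        ⟨p.1, Submodule.span_le.2 (by rintro _ ⟨i, rfl⟩; exact (p.2.1 i).2)⟩⟩
      invFun := fun p => ⟨p.2.1, ⟨fun i => ⟨p.1.1 i,
          p.2.2 (Submodule.subset_span ⟨i, rfl⟩)⟩,
        LinearIndependent.of_comp (LinearMap.ker p.2.1.1).subtype p.1.2⟩⟩
      left_inv := fun p => rfl
      right_inv := fun p => rfl }
  have h := Nat.card_congr e
  rw [Nat.card_sigma, Nat.card_sigma] at h
  have h2 : ∀ v : {v : Fin z → E // LinearIndependent F v},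
      Nat.card {A : C // Submodule.span F (Set.range v.1) ≤ LinearMap.ker A.1} =
        Fintype.card F ^ (finrank F Y * (finrank F E + 1 - d - z)) := by
    intro v
    rw [natCard_vanishing_of_mrd C hd hda hcard hrank, finrank_span_eq_card v.2, Fintype.card_fin]
  simp_rw [h2] at h
  rw [Finset.sum_const, Finset.card_univ, smul_eq_mul, ← Nat.card_eq_fintype_card] at h
  have h3 := congrArg (Nat.cast : ℕ → ℚ) h
  rw [Nat.cast_sum, Nat.cast_mul, natCard_linearIndependent_cast] at h3
  simp_rw [natCard_linearIndependent_cast] at h3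
  -- Dividing the counts of independent `z`-tuples by the number of ordered bases of a
  -- `z`-dimensional space gives the counts of `z`-dimensional subspaces.
  simp_rw [gaussBinom, Finset.prod_div_distrib]
  rw [← Finset.sum_div, h3, Nat.cast_pow]
  ring

/-- Delsarte's formula for the number of maps of a given positive rank in a code attaining the
Singleton-like bound. -/
theorem card_filter_finrank_range_of_mrd (C : AddSubgroup (E →ₗ[F] Y)) [Fintype C] {d i : ℕ}
    (hab : finrank F E ≤ finrank F Y) (hd : 1 ≤ d) (hdi : d ≤ i) (hi : i ≤ finrank F E)
    (hcard : Nat.card C = Fintype.card F ^ (finrank F Y * (finrank F E + 1 - d)))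
    (hrank : ∀ A ∈ C, A ≠ 0 → d ≤ finrank F (LinearMap.range A)) :
    ((Finset.univ.filter fun A : C => finrank F (LinearMap.range A.1) = i).card : ℚ) =
      rankDistr (Fintype.card F) (finrank F E) (finrank F Y) d i := by
  classical
  set q := Fintype.card F with hq
  set a := finrank F E with ha
  set b := finrank F Y with hb
  have hq2 : 2 ≤ q := Fintype.one_lt_card
  let c : ℕ → ℚ := fun j =>
    (-1 : ℚ) ^ j * (q : ℚ) ^ (j * (j - 1) / 2) * gaussBinom q (a - i + j) j
  have hker : ∀ A : E →ₗ[F] Y, finrank F (LinearMap.range A) + finrank F (LinearMap.ker A) = a :=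
    fun A => A.finrank_range_add_finrank_ker
  -- Rank `i` means nullity `a - i`, so the inversion formula expresses the indicator of rank `i`
  -- through the numbers of subspaces of the kernel.
  have hpoint : ∀ A : C, ∑ j ∈ Finset.range (i + 1),
      c j * gaussBinom q (finrank F (LinearMap.ker A.1)) (a - i + j) =
        if finrank F (LinearMap.range A.1) = i then 1 else 0 := by
    intro A
    have h1 := hker A.1
    rw [sum_alternating_gaussBinom_mul hq2 (by omega)]
    refine if_congr ?_ rfl rfl
    omega
  -- The same formula at nullity `a`, that of the zero map, gives `0` because `i ≥ 1`. Subtracting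
  -- it produces the `- 1` in Delsarte's formula.
  have hzero : ∑ j ∈ Finset.range (i + 1), c j * gaussBinom q a (a - i + j) = 0 := by
    rw [sum_alternating_gaussBinom_mul hq2 (by omega), if_neg (by omega)]
  have hsum : ((Finset.univ.filter fun A : C => finrank F (LinearMap.range A.1) = i).card : ℚ) =
      ∑ j ∈ Finset.range (i + 1), c j * gaussBinom q a (a - i + j) *
        ((q : ℚ) ^ (b * (a + 1 - d - (a - i + j))) - 1) := by
    have : ∀ j, c j * gaussBinom q a (a - i + j) *
        ((q : ℚ) ^ (b * (a + 1 - d - (a - i + j))) - 1) =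
        c j * (∑ A : C, gaussBinom q (finrank F (LinearMap.ker A.1)) (a - i + j)) -
          c j * gaussBinom q a (a - i + j) := by
      intro j
      rw [sum_gaussBinom_finrank_ker_of_mrd C hd (hdi.trans hi) hcard hrank]
      ring
    simp_rw [this]
    rw [Finset.sum_sub_distrib, hzero, sub_zero]
    simp_rw [Finset.mul_sum]
    rw [Finset.sum_comm]
    simp_rw [hpoint]
    rw [Finset.card_filter]
    push_cast
    rfl
  rw [hsum, rankDistr, min_eq_left hab, max_eq_right hab, Finset.mul_sum]
  symm
  -- For `j > i - d` the truncated exponent is `0`, so the factor `q ^ 0 - 1` removes the term.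
  have hsub : Finset.range (i - d + 1) ⊆ Finset.range (i + 1) :=
    Finset.range_subset_range.2 (by omega)
  rw [← Finset.sum_subset hsub]
  · refine Finset.sum_congr rfl fun j hj => ?_
    rw [Finset.mem_range] at hj
    have e1 : a + 1 - d - (a - i + j) = i - d - j + 1 := by omega
    rw [e1]
    have := gaussBinom_mul_gaussBinom_sub hq2 hi (by omega : j ≤ i)
    simp only [c]
    linear_combination (-1 : ℚ) ^ j * (q : ℚ) ^ (j * (j - 1) / 2) *
      ((q : ℚ) ^ (b * (i - d - j + 1)) - 1) * this
  · intro j _ hj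
    rw [Finset.mem_range] at hj
    have e1 : a + 1 - d - (a - i + j) = 0 := by omega
    rw [e1, mul_zero, pow_zero, sub_self, mul_zero]

/-- The number of maps of rank at most `r` in a code attaining the Singleton-like bound. -/
theorem natCard_finrank_range_le_of_mrd (C : AddSubgroup (E →ₗ[F] Y)) {d r : ℕ}
    (hab : finrank F E ≤ finrank F Y) (hd : 1 ≤ d) (hr : r ≤ finrank F E)
    (hcard : Nat.card C = Fintype.card F ^ (finrank F Y * (finrank F E + 1 - d)))
    (hrank : ∀ A ∈ C, A ≠ 0 → d ≤ finrank F (LinearMap.range A)) :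
    (Nat.card {A : C // finrank F (LinearMap.range A.1) ≤ r} : ℚ) =
      rrmcSize (Fintype.card F) (finrank F E) (finrank F Y) d r := by
  classical
  have hfin : Finite (E →ₗ[F] Y) := Module.finite_of_finite F
  have hfinC : Fintype C := Fintype.ofFinite _
  have hr0 : finrank F (LinearMap.range ((0 : C) : E →ₗ[F] Y)) = 0 := by
    rw [AddSubgroup.coe_zero, LinearMap.range_zero, finrank_bot]
  have hset : (Finset.univ.filter fun A : C => finrank F (LinearMap.range A.1) ≤ r) =
      insert 0 (Finset.univ.filter fun A : C => finrank F (LinearMap.range A.1) ∈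
        Finset.Icc d r) := by
    ext A
    simp only [Finset.mem_filter, Finset.mem_univ, true_and, Finset.mem_insert, Finset.mem_Icc]
    constructor
    · intro h
      by_cases h0 : A = 0
      · exact Or.inl h0
      · exact Or.inr ⟨hrank A.1 A.2 (fun h => h0 (Subtype.ext h)), h⟩
    · rintro (rfl | h)
      · exact hr0.trans_le (Nat.zero_le r)
      · exact h.2
  have hnot : (0 : C) ∉ Finset.univ.filter fun A : C => finrank F (LinearMap.range A.1) ∈
      Finset.Icc d r := by
    simp only [Finset.mem_filter, Finset.mem_univ, true_and, Finset.mem_Icc, not_and]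
    intro h
    omega
  rw [Nat.card_eq_fintype_card, Fintype.card_subtype, hset, Finset.card_insert_of_notMem hnot,
    Finset.card_eq_sum_card_fiberwise
      (s := Finset.univ.filter fun A : C => finrank F (LinearMap.range A.1) ∈ Finset.Icc d r)
      (t := Finset.Icc d r)
      (f := fun A : C => finrank F (LinearMap.range A.1)) (fun A hA => (Finset.mem_filter.1 hA).2),
    rrmcSize, Nat.cast_add, Nat.cast_one, add_comm, Nat.cast_sum]
  congr 1
  refine Finset.sum_congr rfl fun i hi => ?_
  obtain ⟨h1, h2⟩ := Finset.mem_Icc.1 hi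
  rw [← card_filter_finrank_range_of_mrd C hab hd h1 (h2.trans hr) hcard hrank,
    Finset.filter_filter]
  congr 2
  refine Finset.filter_congr fun A _ => ?_
  constructor
  · exact fun h => h.2
  · intro h
    exact ⟨h ▸ hi, h⟩

end RankDistribution

/-! ### Gabidulin codes: existence of nested MRD codes. -/

section Gabidulin

open Module Polynomial

/-- The linearized polynomial map `x ↦ ∑ cᵢ x ^ (q ^ i)`. -/
noncomputable def linearizedMap (F K : Type*) [Field F] [Fintype F] [Field K] [Algebra F K]
    {a : ℕ} (c : Fin a → K) : K →ₗ[F] K :=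
  ∑ i, c i • ((FiniteField.frobeniusAlgHom F K) ^ (i : ℕ)).toLinearMap

variable {F K : Type*} [Field F] [Fintype F] [Field K] [Algebra F K]

theorem linearizedMap_apply {a : ℕ} (c : Fin a → K) (x : K) :
    linearizedMap F K c x = ∑ i, c i * x ^ (Fintype.card F ^ (i : ℕ)) := by
  have h : ∀ i : ℕ, ((FiniteField.frobeniusAlgHom F K) ^ i) x = x ^ (Fintype.card F ^ i) := by
    intro i
    induction i with
    | zero => simp
    | succ i ih =>
      rw [pow_succ', AlgHom.mul_apply, ih, FiniteField.frobeniusAlgHom_apply, ← pow_mul, pow_succ]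
  rw [linearizedMap, LinearMap.sum_apply]
  exact Finset.sum_congr rfl fun i _ => by
    rw [LinearMap.smul_apply, AlgHom.toLinearMap_apply, h, smul_eq_mul]

theorem linearizedMap_add {a : ℕ} (c c' : Fin a → K) :
    linearizedMap F K (c + c') = linearizedMap F K c + linearizedMap F K c' := by
  simp only [linearizedMap, Pi.add_apply, add_smul, Finset.sum_add_distrib]

/-- A nonzero linearized polynomial of `q`-degree less than `κ` has nullity less than `κ`. -/
theorem finrank_ker_linearizedMap_lt [FiniteDimensional F K] {a κ : ℕ} {c : Fin a → K}
    (hc : c ≠ 0) (hκ : ∀ i : Fin a, κ ≤ i → c i = 0) :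
    finrank F (LinearMap.ker (linearizedMap F K c)) < κ := by
  classical
  have hfin : Finite K := Module.finite_of_finite F
  obtain ⟨i₀, hi₀⟩ := Function.ne_iff.1 hc
  have hκ0 : 0 < κ := by
    by_contra h
    exact hi₀ (hκ i₀ (by omega))
  have hq : 1 < Fintype.card F := Fintype.one_lt_card
  let p : K[X] := ∑ i, C (c i) * X ^ (Fintype.card F ^ (i : ℕ))
  have hp : p ≠ 0 := by
    intro h0
    have h1 : p.coeff (Fintype.card F ^ (i₀ : ℕ)) = c i₀ := by
      simp only [p, finsetSum_coeff, coeff_C_mul, coeff_X_pow]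
      rw [Finset.sum_eq_single i₀]
      · simp
      · intro i _ hi
        rw [if_neg, mul_zero]
        intro h
        exact hi (Fin.ext (Nat.pow_right_injective hq h.symm))
      · simp
    rw [h0, coeff_zero] at h1
    exact hi₀ h1.symm
  have hdeg : p.natDegree ≤ Fintype.card F ^ (κ - 1) := by
    refine natDegree_sum_le_of_forall_le _ _ fun i _ => ?_
    by_cases h : κ ≤ i
    · simp [hκ i h]
    · exact (natDegree_C_mul_X_pow_le _ _).trans (Nat.pow_le_pow_right hq.le (by omega))
  -- The `q ^ nullity` elements of the kernel are roots of a nonzero polynomial of degree at most `q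
  -- ^ (κ - 1)`, which forces nullity at most `κ - 1`.
  have hroots : Nat.card (LinearMap.ker (linearizedMap F K c)) ≤ p.roots.toFinset.card := by
    have hmem : ∀ x : LinearMap.ker (linearizedMap F K c), x.1 ∈ p.roots.toFinset := by
      intro x
      rw [Multiset.mem_toFinset, mem_roots hp, IsRoot.def]
      have := x.2
      rw [LinearMap.mem_ker, linearizedMap_apply] at this
      simpa [p, eval_finsetSum] using this
    have := Nat.card_le_card_of_injective
      (fun x : LinearMap.ker (linearizedMap F K c) => (⟨x.1, hmem x⟩ : p.roots.toFinset))
      fun x y hxy => Subtype.ext (Subtype.mk.inj hxy)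
    rwa [Nat.card_eq_fintype_card (α := p.roots.toFinset), Fintype.card_coe] at this
  rw [Module.natCard_eq_pow_finrank (K := F), Nat.card_eq_fintype_card] at hroots
  have h2 : Fintype.card F ^ finrank F (LinearMap.ker (linearizedMap F K c)) ≤
      Fintype.card F ^ (κ - 1) :=
    hroots.trans ((Multiset.toFinset_card_le _).trans ((card_roots' p).trans hdeg))
  have := (Nat.pow_le_pow_iff_right hq).1 h2
  omega

/-- Sequences of coefficients vanishing from index `κ` on. -/
def vanishingFrom (K : Type*) [Field K] (a κ : ℕ) : AddSubgroup (Fin a → K) where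
  carrier := {c | ∀ i : Fin a, κ ≤ i → c i = 0}
  zero_mem' := fun _ _ => rfl
  add_mem' := fun {c c'} hc hc' i hi => by rw [Pi.add_apply, hc i hi, hc' i hi, add_zero]
  neg_mem' := fun {c} hc i hi => by rw [Pi.neg_apply, hc i hi, neg_zero]

theorem natCard_vanishingFrom (K : Type*) [Field K] {a κ : ℕ} (h : κ ≤ a) :
    Nat.card (vanishingFrom K a κ) = Nat.card K ^ κ := by
  let e : vanishingFrom K a κ ≃ (Fin κ → K) :=
    { toFun := fun c i => c.1 (Fin.castLE h i)
      invFun := fun c => ⟨fun i => if hi : (i : ℕ) < κ then c ⟨i, hi⟩ else 0,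
        fun i hi => dif_neg (not_lt.2 hi)⟩
      left_inv := fun c => by
        ext i
        by_cases hi : (i : ℕ) < κ
        · simp [hi]
        · simpa [hi] using (c.2 i (not_lt.1 hi)).symm
      right_inv := fun c => by
        ext i
        simp }
  rw [Nat.card_congr e, Nat.card_fun, Nat.card_eq_fintype_card (α := Fin κ), Fintype.card_fin]

/-- A nested family of additive codes attaining the Singleton-like bound, for `a ≤ b`. -/
theorem exists_mrd_of_le (F : Type*) [Field F] [Fintype F] {a b : ℕ} (hab : a ≤ b) :
    ∃ G : ℕ → AddSubgroup ((Fin a → F) →ₗ[F] (Fin b → F)), Antitone G ∧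
      (∀ d, 1 ≤ d → d ≤ a → Nat.card (G d) = Fintype.card F ^ (b * (a + 1 - d))) ∧
      ∀ d, ∀ A ∈ G d, A ≠ 0 → d ≤ finrank F (LinearMap.range A) := by
  -- The field extension below needs positive degree `b`. For `b = 0` also `a = 0`, and the
  -- cardinality condition is vacuous.
  rcases Nat.eq_zero_or_pos b with rfl | hb
  · obtain rfl : a = 0 := by omega
    exact ⟨fun _ => ⊥, fun _ _ _ => le_rfl, fun d h1 h2 => by omega,
      fun d A hA h0 => absurd (AddSubgroup.mem_bot.1 hA) h0⟩
  obtain ⟨p, hchar⟩ := CharP.exists F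
  have hp : Fact p.Prime := ⟨CharP.char_is_prime F p⟩
  have hb' : NeZero b := ⟨hb.ne'⟩
  let K := FiniteField.Extension F p b
  have hK : finrank F K = b := FiniteField.finrank_extension F p b
  have hfinK : FiniteDimensional F K := FiniteDimensional.of_finrank_pos (by omega)
  let e : K ≃ₗ[F] (Fin b → F) := LinearEquiv.ofFinrankEq _ _ (by simp [hK])
  -- Linearized polynomials with `a + 1 - d` coefficients are restricted to an `a`-dimensional
  -- subspace of `K`. Their nullity is at most `a - d`, so the rank is at least `d`.
  let ι : (Fin a → F) →ₗ[F] K := e.symm.toLinearMap ∘ₗ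
    Function.ExtendByZero.linearMap F (Fin.castLE hab)
  have hι : Function.Injective ι := e.symm.injective.comp
    (Function.extend_injective (f := Fin.castLE hab) (Fin.castLE_injective hab) 0)
  let L : (Fin a → K) →+ ((Fin a → F) →ₗ[F] (Fin b → F)) :=
    AddMonoidHom.mk' (fun c => e.toLinearMap ∘ₗ linearizedMap F K c ∘ₗ ι) (by
      intro c c'
      rw [linearizedMap_add, LinearMap.add_comp, LinearMap.comp_add])
  have hLker : ∀ c, finrank F (LinearMap.ker (L c)) ≤
      finrank F (LinearMap.ker (linearizedMap F K c)) := by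
    intro c
    refine LinearMap.finrank_le_finrank_of_injective
      (f := ι.restrict (p := LinearMap.ker (L c)) (q := LinearMap.ker (linearizedMap F K c)) ?_) ?_
    · intro x hx
      exact e.map_eq_zero_iff.1 hx
    · intro x y hxy
      exact Subtype.ext (hι (congrArg Subtype.val hxy))
  have hLrank : ∀ (d : ℕ) c, c ∈ vanishingFrom K a (a + 1 - d) → c ≠ 0 →
      d ≤ finrank F (LinearMap.range (L c)) := by
    intro d c hc h0
    have h1 := finrank_ker_linearizedMap_lt (F := F) h0 hc
    have h2 := hLker c
    have h3 := (L c).finrank_range_add_finrank_ker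
    rw [Module.finrank_fin_fun] at h3
    omega
  refine ⟨fun d => (vanishingFrom K a (a + 1 - d)).map L, ?_, ?_, ?_⟩
  · intro d d' h
    refine AddSubgroup.map_mono ?_
    intro c hc i hi
    exact hc i (by omega)
  · intro d hd hda
    have hinj : Function.Injective fun c : vanishingFrom K a (a + 1 - d) => L c.1 := by
      intro c c' hcc
      by_contra hne
      have h1 : c.1 - c'.1 ≠ 0 := fun h => hne (Subtype.ext (sub_eq_zero.1 h))
      have h2 := hLrank d _ ((vanishingFrom K a (a + 1 - d)).sub_mem c.2 c'.2) h1
      rw [map_sub, sub_eq_zero.2 hcc, LinearMap.range_zero, finrank_bot] at h2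
      omega
    have h4 : Nat.card ((vanishingFrom K a (a + 1 - d)).map L) =
        Nat.card (vanishingFrom K a (a + 1 - d)) :=
      Nat.card_image_of_injOn (fun x hx y hy h => congrArg Subtype.val
        (@hinj ⟨x, hx⟩ ⟨y, hy⟩ h))
    rw [h4, natCard_vanishingFrom K (by omega), Module.natCard_eq_pow_finrank (K := F), hK,
      Nat.card_eq_fintype_card, pow_mul]
  · rintro d _ ⟨c, hc, rfl⟩ h0
    refine hLrank d c hc ?_
    rintro rfl
    exact h0 (map_zero L)

/-- A nested family of additive codes attaining the Singleton-like bound. -/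
theorem exists_mrd (F : Type*) [Field F] [Fintype F] (a b : ℕ) :
    ∃ G : ℕ → AddSubgroup ((Fin a → F) →ₗ[F] (Fin b → F)), Antitone G ∧
      (∀ d, 1 ≤ d → d ≤ min a b → Nat.card (G d) = mrdSize (Fintype.card F) a b d) ∧
      ∀ d, ∀ A ∈ G d, A ≠ 0 → d ≤ finrank F (LinearMap.range A) := by
  rcases le_total a b with h | h
  · obtain ⟨G, h1, h2, h3⟩ := exists_mrd_of_le F h
    refine ⟨G, h1, fun d hd hda => ?_, h3⟩
    rw [min_eq_left h] at hda
    rw [h2 d hd hda, mrdSize, min_eq_left h, max_eq_right h]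
  · obtain ⟨G, h1, h2, h3⟩ := exists_mrd_of_le F h
    -- Transposition preserves rank and reduces to the case of the smaller side first.
    let τ : ((Fin b → F) →ₗ[F] (Fin a → F)) ≃+ ((Fin a → F) →ₗ[F] (Fin b → F)) :=
      (LinearMap.toMatrix'.toAddEquiv.trans (Matrix.transposeAddEquiv (Fin a) (Fin b) F)).trans
        Matrix.toLin'.toAddEquiv
    have hτ : ∀ A, finrank F (LinearMap.range (τ A)) = finrank F (LinearMap.range A) := by
      intro A
      have h4 : τ A = Matrix.toLin' (LinearMap.toMatrix' A).transpose := rfl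
      have h5 := Matrix.rank_transpose (LinearMap.toMatrix' A)
      rw [Matrix.rank, Matrix.rank, ← Matrix.toLin'_apply', ← Matrix.toLin'_apply',
        Matrix.toLin'_toMatrix'] at h5
      rw [h4, h5]
    refine ⟨fun d => (G d).map τ.toAddMonoidHom, fun d d' hd => AddSubgroup.map_mono (h1 hd),
      fun d hd hda => ?_, ?_⟩
    · rw [min_eq_right h] at hda
      rw [mrdSize, min_eq_right h, max_eq_left h, ← h2 d hd hda]
      exact Nat.card_image_of_injective τ.injective _
    · rintro d _ ⟨A, hA, rfl⟩ h0
      have h4 := h3 d A hA (by rintro rfl; exact h0 (map_zero _))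
      exact h4.trans_eq (hτ A).symm

end Gabidulin

/-! ### Bounds for intersections of subspaces. -/

section SubspaceDimensions

open Module

variable {F : Type*} [Field F] {V Y : Type*} [AddCommGroup V] [Module F V]
  [FiniteDimensional F V] [AddCommGroup Y] [Module F Y]

theorem finrank_map_add_finrank_inf_ker (ρ : V →ₗ[F] Y) (W : Submodule F V) :
    finrank F (W.map ρ) + finrank F (W ⊓ LinearMap.ker ρ : Submodule F V) = finrank F W := by
  have h := (ρ.domRestrict W).finrank_range_add_finrank_ker
  have h2 : (LinearMap.ker (ρ.domRestrict W)).map W.subtype = W ⊓ LinearMap.ker ρ := by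
    ext x
    constructor
    · rintro ⟨y, hy, rfl⟩
      exact ⟨y.2, hy⟩
    · rintro ⟨hx, hx'⟩
      exact ⟨⟨x, hx⟩, hx', rfl⟩
  rw [LinearMap.range_domRestrict, ← Submodule.finrank_map_subtype_eq, h2] at h
  exact h

theorem finrank_inf_le_of_map (ρ : V →ₗ[F] Y) (W W' : Submodule F V) :
    finrank F (W ⊓ W' : Submodule F V) ≤
      finrank F (W.map ρ ⊓ W'.map ρ : Submodule F Y) +
        finrank F (W ⊓ W' ⊓ LinearMap.ker ρ : Submodule F V) := by
  rw [← finrank_map_add_finrank_inf_ker ρ (W ⊓ W')]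
  have : FiniteDimensional F (W.map ρ ⊓ W'.map ρ : Submodule F Y) :=
    Submodule.finiteDimensional_inf_left _ _
  exact Nat.add_le_add_right (Submodule.finrank_mono (Submodule.map_inf_le ρ)) _

/-- `W ⊓ W'` and `W' ⊓ K` are independent inside `W'`, since their intersection lies in `W ⊓ K`.
This separates the three families from each other. -/
theorem finrank_inf_add_le_of_inf_eq_bot {W W' K : Submodule F V} {d : ℕ} (h : W ⊓ K = ⊥)
    (h' : d ≤ finrank F (W' ⊓ K : Submodule F V)) :
    finrank F (W ⊓ W' : Submodule F V) + d ≤ finrank F W' := by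
  have h1 := Submodule.finrank_sup_add_finrank_inf_eq (W ⊓ W') (W' ⊓ K)
  have h2 : (W ⊓ W') ⊓ (W' ⊓ K) = ⊥ :=
    le_bot_iff.1 (h ▸ le_inf (inf_le_left.trans inf_le_left) (inf_le_right.trans inf_le_right))
  have h3 : (W ⊓ W') ⊔ (W' ⊓ K) ≤ W' := sup_le inf_le_right inf_le_left
  have h4 := Submodule.finrank_mono h3
  rw [h2, finrank_bot] at h1
  omega

end SubspaceDimensions

/-! ### Lifted words and their position relative to a subspace. -/

section LiftWord

open Module

variable {F : Type*} [Field F] {V P B D : Type*} [AddCommGroup V] [Module F V]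
  [AddCommGroup P] [Module F P] [AddCommGroup B] [Module F B] [AddCommGroup D] [Module F D]

/-- The lift of the row space of `g` by the map `M`, placed into `V` by `Φ`. -/
def liftWord (Φ : P × B →ₗ[F] V) (g : D →ₗ[F] P) (M : D →ₗ[F] B) : Submodule F V :=
  LinearMap.range (Φ ∘ₗ g.prod M)

theorem finrank_liftWord {Φ : P × B →ₗ[F] V} {g : D →ₗ[F] P} (M : D →ₗ[F] B)
    (hΦ : Function.Injective Φ) (hg : Function.Injective g) :
    finrank F (liftWord Φ g M) = finrank F D := by
  refine LinearMap.finrank_range_of_inj fun x y hxy => ?_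
  exact hg (Prod.ext_iff.1 (hΦ hxy)).1

/-- Injectivity of `g` forces a common vector to come from one and the same preimage under both
lifts, and on it `M` and `M'` agree. -/
theorem finrank_liftWord_inf_add_le [FiniteDimensional F D] {Φ : P × B →ₗ[F] V} {g : D →ₗ[F] P} (M M' : D →ₗ[F] B)
    (hΦ : Function.Injective Φ) (hg : Function.Injective g) :
    finrank F (liftWord Φ g M ⊓ liftWord Φ g M' : Submodule F V) +
      finrank F (LinearMap.range (M - M')) ≤ finrank F D := by
  have h : liftWord Φ g M ⊓ liftWord Φ g M' ≤
      (LinearMap.ker (M - M')).map (Φ ∘ₗ g.prod M) := by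
    rintro v ⟨⟨x, rfl⟩, ⟨y, hy⟩⟩
    have h1 := Prod.ext_iff.1 (hΦ hy)
    obtain rfl : y = x := hg h1.1
    exact ⟨y, by simpa [sub_eq_zero] using h1.2.symm, rfl⟩
  have h2 := (Submodule.finrank_mono h).trans (Submodule.finrank_map_le _ _)
  have h3 := (M - M').finrank_range_add_finrank_ker
  omega

theorem liftWord_inf_eq_bot {Φ : P × B →ₗ[F] V} {g : D →ₗ[F] P} (M : D →ₗ[F] B)
    (hg : Function.Injective g) {K : Submodule F V}
    (hK : ∀ p : P × B, Φ p ∈ K → p.1 = 0) : liftWord Φ g M ⊓ K = ⊥ := by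
  rw [eq_bot_iff]
  rintro v ⟨⟨x, rfl⟩, hv⟩
  have h1 : g x = 0 := hK _ hv
  have h2 : x = 0 := hg (h1.trans (map_zero g).symm)
  rw [h2, map_zero]
  exact Submodule.zero_mem _

/-- On `ker M` the lift has no `B`-component, so its image lies in `K`; the rank bound makes this
kernel large. This is where rank restriction pays off. -/
theorem le_finrank_liftWord_inf [FiniteDimensional F V] [FiniteDimensional F D]
    {Φ : P × B →ₗ[F] V} {g : D →ₗ[F] P} {M : D →ₗ[F] B}
    (hΦ : Function.Injective Φ) (hg : Function.Injective g) {K : Submodule F V}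
    (hK : ∀ p, Φ (p, 0) ∈ K) {d : ℕ}
    (hM : finrank F (LinearMap.range M) + d ≤ finrank F D) :
    d ≤ finrank F (liftWord Φ g M ⊓ K : Submodule F V) := by
  have h1 := M.finrank_range_add_finrank_ker
  have hinj : Function.Injective (Φ ∘ₗ g.prod M) :=
    fun x y hxy => hg (Prod.ext_iff.1 (hΦ hxy)).1
  have h2 : (LinearMap.ker M).map (Φ ∘ₗ g.prod M) ≤ liftWord Φ g M ⊓ K := by
    rintro _ ⟨x, hx, rfl⟩
    refine ⟨⟨x, rfl⟩, ?_⟩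
    have h3 : M x = 0 := hx
    have h4 := hK (g x)
    rw [← h3] at h4
    exact h4
  have h3 := Submodule.finrank_mono h2
  rw [← (Submodule.equivMapOfInjective _ hinj _).finrank_eq] at h3
  omega

end LiftWord

/-! ### Lower bounds for the maximal code size, and consequences of the code distances. -/

section MaxCDC

open Module

variable {F : Type*} [Field F] {n : ℕ}

/-- A family of `k`-dimensional subspaces with pairwise small intersections bounds the maximal size
of a constant dimension code from below. -/
theorem ncard_le_maxCDCSize [Fintype F] {k δ : ℕ} (hk : k ≤ n)
    {S : Set (Submodule F (Fin n → F))} (hS : ∀ W ∈ S, finrank F W = k)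
    (hdist : ∀ W ∈ S, ∀ W' ∈ S, W ≠ W' →
      finrank F (W ⊓ W' : Submodule F (Fin n → F)) + δ ≤ k) :
    S.ncard ≤ maxCDCSize F n (2 * δ) k := by
  rcases S.eq_empty_or_nonempty with rfl | hne
  · simp
  have hfin : Finite (Submodule F (Fin n → F)) :=
    Finite.of_injective (fun U : Submodule F (Fin n → F) => (U : Set (Fin n → F)))
      SetLike.coe_injective
  refine (isGreatest_maxCDCSize F n (2 * δ) k hk).2 ⟨S, ⟨hne, ?_, ?_, ?_⟩, rfl⟩
  · intro U hU W hW hUW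
    have h1 := Submodule.finrank_sup_add_finrank_inf_eq U W
    have h2 := hdist U hU W hW hUW
    rw [hS U hU, hS W hW] at h1
    rw [subspaceDist]
    omega
  · intro i hi
    obtain rfl := Finset.mem_singleton.1 hi
    obtain ⟨W, hW⟩ := hne
    exact (Set.ncard_pos (Set.toFinite _)).2 ⟨W, hW, hS W hW⟩
  · intro i hi
    refine (Set.ncard_eq_zero (Set.toFinite _)).2 (Set.eq_empty_iff_forall_notMem.2 ?_)
    rintro U ⟨hU, hU'⟩
    exact hi (Finset.mem_singleton.2 (hU'.symm.trans (hS U hU)))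

/-- The truncated subtraction in `subspaceDist` is exact because the intersection lies in the sum;
the dimension formula then eliminates the sum. -/
theorem finrank_inf_le_of_subspaceDist {U W : Submodule F (Fin n → F)} {d : ℕ}
    (h : d ≤ subspaceDist U W) :
    2 * finrank F (U ⊓ W : Submodule F (Fin n → F)) + d ≤ finrank F U + finrank F W := by
  have h1 := Submodule.finrank_sup_add_finrank_inf_eq U W
  have h2 := Submodule.finrank_mono (inf_le_left.trans le_sup_left :
    U ⊓ W ≤ (U ⊔ W : Submodule F (Fin n → F)))
  rw [subspaceDist] at h
  omega

theorem minGap_le {T : Finset ℕ} {u v : ℕ} (hu : u ∈ T) (hv : v ∈ T) (h : v < u) :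
    minGap T ≤ u - v := by
  rw [minGap, if_pos (Finset.one_lt_card.2 ⟨u, hu, v, hv, h.ne'⟩)]
  exact Nat.sInf_le ⟨u, hu, v, hv, h, rfl⟩

theorem finrank_mem_of_dimDistr_eq_zero [Finite F] {T : Finset ℕ}
    {X : Set (Submodule F (Fin n → F))} (h : ∀ i, i ∉ T → dimDistr X i = 0) {U}
    (hU : U ∈ X) : finrank F U ∈ T := by
  have hfin : Finite (Submodule F (Fin n → F)) :=
    Finite.of_injective (fun U : Submodule F (Fin n → F) => (U : Set (Fin n → F)))
      SetLike.coe_injective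
  by_contra hnot
  have := (Set.ncard_eq_zero (Set.toFinite _)).1 (h _ hnot)
  exact Set.eq_empty_iff_forall_notMem.1 this U ⟨hU, rfl⟩

theorem sum_eq_sum_dimDistr {T : Finset ℕ} {X : Set (Submodule F (Fin n → F))} [Fintype X]
    (h : ∀ U ∈ X, finrank F U ∈ T) (f : ℕ → ℕ) :
    ∑ U : X, f (finrank F U.1) = ∑ t ∈ T, dimDistr X t * f t := by
  classical
  rw [← Finset.sum_fiberwise_of_maps_to (t := T) (g := fun U : X => finrank F U.1)
    (fun U _ => h U.1 U.2)]
  refine Finset.sum_congr rfl fun t _ => ?_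
  rw [Finset.sum_congr rfl (g := fun _ => f t)
    (fun U hU => by rw [(Finset.mem_filter.1 hU).2]), Finset.sum_const, smul_eq_mul]
  congr 1
  rw [dimDistr, ← Fintype.card_subtype, ← Nat.card_eq_fintype_card, ← Nat.card_coe_set_eq]
  exact Nat.card_congr (Equiv.subtypeSubtypeEquivSubtypeInter (· ∈ X) (fun U => finrank F U = t))

end MaxCDC

/-! ### Lifting the codewords of an MDDC. -/

section SideFamily

open Module

variable {F : Type*} [Field F]

/-- The block diagonal generator matrix of `U` and an identity pads every codeword to dimension `k`,
whatever its own dimension. -/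
theorem exists_range_eq_prod_top {m k t : ℕ} (U : Submodule F (Fin m → F))
    (hU : finrank F U = t) (ht : t ≤ k) :
    ∃ g : (Fin k → F) →ₗ[F] (Fin m → F) × (Fin (k - t) → F), Function.Injective g ∧
      LinearMap.range g = U.prod ⊤ := by
  let e : (Fin k → F) ≃ₗ[F] U × (Fin (k - t) → F) :=
    LinearEquiv.ofFinrankEq _ _ (by simp [hU, ht])
  let s : U × (Fin (k - t) → F) →ₗ[F] (Fin m → F) × (Fin (k - t) → F) :=
    U.subtype.prodMap LinearMap.id
  have hs : Function.Injective s := by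
    intro x y hxy
    have := Prod.ext_iff.1 hxy
    exact Prod.ext (Subtype.ext this.1) this.2
  refine ⟨s ∘ₗ e.toLinearMap, hs.comp e.injective, ?_⟩
  rw [LinearMap.range_comp, LinearEquiv.range, Submodule.map_top]
  ext x
  constructor
  · rintro ⟨y, rfl⟩
    exact ⟨y.1.2, trivial⟩
  · rintro ⟨h, -⟩
    exact ⟨(⟨x.1, h⟩, x.2), rfl⟩

/-- The words obtained by lifting the codewords of an MDDC. -/
theorem exists_lifted_family [Fintype F] {V : Type*} [AddCommGroup V] [Module F V]
    [FiniteDimensional F V] {m k δ : ℕ} {T : Finset ℕ} (hT : ∀ t ∈ T, t ≤ k)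
    (hl : minGap T < 2 * δ) {X : Set (Submodule F (Fin m → F))}
    (hX : IsMDDC (2 * δ) (2 * δ - minGap T) T X) (b : ℕ → ℕ)
    (Φ : ∀ t, ((Fin m → F) × (Fin (k - t) → F)) × (Fin (b t) → F) →ₗ[F] V)
    (hΦ : ∀ t ∈ T, Function.Injective (Φ t)) (ρ : V →ₗ[F] (Fin m → F))
    (hρ : ∀ t ∈ T, ∀ p, ρ (Φ t p) = p.1.1)
    (C : ∀ t, Set ((Fin k → F) →ₗ[F] (Fin (b t) → F)))
    (hC : ∀ t ∈ T, ∀ M ∈ C t, ∀ M' ∈ C t, M ≠ M' → δ ≤ finrank F (LinearMap.range (M - M'))) :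
    ∃ S : Set (Submodule F V), S.ncard = ∑ t ∈ T, dimDistr X t * Nat.card (C t) ∧
      (∀ W ∈ S, finrank F W = k) ∧
      (∀ W ∈ S, ∀ W' ∈ S, W ≠ W' → finrank F (W ⊓ W' : Submodule F V) + δ ≤ k) ∧
      ∀ W ∈ S, ∃ t ∈ T, ∃ g : (Fin k → F) →ₗ[F] (Fin m → F) × (Fin (k - t) → F),
        ∃ M ∈ C t, Function.Injective g ∧ W = liftWord (Φ t) g M := by
  classical
  obtain ⟨-, -, hX1, hX0, -, hXT⟩ := hX
  have hfin : Finite (Submodule F (Fin m → F)) :=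
    Finite.of_injective (fun U : Submodule F (Fin m → F) => (U : Set (Fin m → F)))
      SetLike.coe_injective
  have hfinX : Fintype X := Fintype.ofFinite _
  have hmem : ∀ U ∈ X, finrank F U ∈ T := fun U hU => finrank_mem_of_dimDistr_eq_zero hXT hU
  have hfinC : ∀ t, Finite (C t) := fun t => by
    have : Finite ((Fin k → F) →ₗ[F] (Fin (b t) → F)) := Module.finite_of_finite F
    infer_instance
  choose g hg hgr using fun U : X =>
    exists_range_eq_prod_top U.1 rfl (hT _ (hmem U.1 U.2))
  let word : (Σ U : X, C (finrank F U.1)) → Submodule F V :=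
    fun p => liftWord (Φ (finrank F p.1.1)) (g p.1) p.2.1
  have hdim : ∀ p, finrank F (word p) = k := fun p => by
    simp only [word]
    rw [finrank_liftWord _ (hΦ _ (hmem _ p.1.2)) (hg p.1), finrank_fin_fun]
  have hmap : ∀ p, (word p).map ρ = p.1.1 := by
    intro p
    ext u
    constructor
    · rintro ⟨_, ⟨x, rfl⟩, rfl⟩
      have h1 : g p.1 x ∈ p.1.1.prod ⊤ := hgr p.1 ▸ LinearMap.mem_range_self _ x
      rw [LinearMap.comp_apply, hρ _ (hmem _ p.1.2)]
      exact h1.1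
    · intro hu
      have h1 : ((u, 0) : (Fin m → F) × (Fin (k - finrank F p.1.1) → F)) ∈
          LinearMap.range (g p.1) := by
        rw [hgr]
        exact ⟨hu, trivial⟩
      obtain ⟨x, hx⟩ := h1
      refine ⟨_, ⟨x, rfl⟩, ?_⟩
      rw [LinearMap.comp_apply, hρ _ (hmem _ p.1.2)]
      exact congrArg Prod.fst hx
  have hker : ∀ p, finrank F p.1.1 +
      finrank F (word p ⊓ LinearMap.ker ρ : Submodule F V) = k := by
    intro p
    have := finrank_map_add_finrank_inf_ker ρ (word p)
    rwa [hmap, hdim] at this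
  have hbound : ∀ p p', finrank F (word p ⊓ word p' : Submodule F V) ≤
      finrank F (p.1.1 ⊓ p'.1.1 : Submodule F (Fin m → F)) +
        finrank F (word p ⊓ word p' ⊓ LinearMap.ker ρ : Submodule F V) := by
    intro p p'
    have := finrank_inf_le_of_map ρ (word p) (word p')
    rwa [hmap, hmap] at this
  -- With `u > u'` the two dimensions, the MDDC distance and `minGap T ≤ u - u'` give `2 * dim (U ⊓
  -- U') ≤ u + u' - 2δ + (u - u')`, that is `dim (U ⊓ U') ≤ u - δ`. The part in `ker ρ` is bounded
  -- through the word with the larger `u`, by `k - u`.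
  have hgap : ∀ p p', finrank F p'.1.1 < finrank F p.1.1 →
      finrank F (word p ⊓ word p' : Submodule F V) + δ ≤ k := by
    intro p p' hlt
    have h1 := finrank_inf_le_of_subspaceDist (hX0 p.1.1 p.1.2 p'.1.1 p'.1.2 hlt.ne')
    have h2 := minGap_le (hmem _ p.1.2) (hmem _ p'.1.2) hlt
    have h3 := hbound p p'
    have h4 := hker p
    have h5 : finrank F (word p ⊓ word p' ⊓ LinearMap.ker ρ : Submodule F V) ≤
        finrank F (word p ⊓ LinearMap.ker ρ : Submodule F V) :=
      Submodule.finrank_mono (inf_le_inf_right _ inf_le_left)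
    omega
  have hdist : ∀ p p', p ≠ p' → finrank F (word p ⊓ word p' : Submodule F V) + δ ≤ k := by
    intro p p' hne
    rcases lt_trichotomy (finrank F p'.1.1) (finrank F p.1.1) with hlt | heq | hgt
    · exact hgap p p' hlt
    · by_cases hU : p.1 = p'.1
      · obtain ⟨U, M⟩ := p
        obtain ⟨U', M'⟩ := p'
        obtain rfl : U = U' := hU
        have hM : M.1 ≠ M'.1 := fun h => hne (by rw [Subtype.ext h])
        have h1 := hC _ (hmem _ U.2) M.1 M.2 M'.1 M'.2 hM
        have h2 := finrank_liftWord_inf_add_le M.1 M'.1 (hΦ _ (hmem _ U.2)) (hg U)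
        rw [finrank_fin_fun] at h2
        simp only [word]
        omega
      · have h1 := finrank_inf_le_of_subspaceDist
          (hX1 p.1.1 p.1.2 p'.1.1 p'.1.2 (fun h => hU (Subtype.ext h)) heq.symm)
        have h3 := hbound p p'
        have h4 := hker p
        have h5 : finrank F (word p ⊓ word p' ⊓ LinearMap.ker ρ : Submodule F V) ≤
            finrank F (word p ⊓ LinearMap.ker ρ : Submodule F V) :=
          Submodule.finrank_mono (inf_le_inf_right _ inf_le_left)
        omega
    · rw [inf_comm]
      exact hgap p' p hgt
  have hinj : Function.Injective word := by
    intro p p' h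
    by_contra hne
    have h1 := hdist p p' hne
    rw [← h, inf_idem, hdim] at h1
    omega
  refine ⟨Set.range word, ?_, ?_, ?_, ?_⟩
  · rw [← Nat.card_coe_set_eq, Nat.card_range_of_injective hinj, Nat.card_sigma]
    exact sum_eq_sum_dimDistr hmem (fun t => Nat.card (C t))
  · rintro _ ⟨p, rfl⟩
    exact hdim p
  · rintro _ ⟨p, rfl⟩ _ ⟨p', rfl⟩ hne
    exact hdist p p' (fun h => hne (congrArg word h))
  · rintro _ ⟨p, rfl⟩
    exact ⟨_, hmem _ p.1.2, g p.1, p.2.1, p.2.2, hg p.1, rfl⟩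

end SideFamily

/-! ### Coordinate windows and shifted identity blocks. -/

section Windows

open Module

variable {F : Type*} [Field F]

/-- Placement of a vector of length `b` at offset `a` in a vector of length `m`. -/
def place (F : Type*) [Field F] (m a b : ℕ) : (Fin b → F) →ₗ[F] (Fin m → F) where
  toFun y i := if h : a ≤ (i : ℕ) ∧ (i : ℕ) < a + b then y ⟨i - a, by omega⟩ else 0
  map_add' y y' := by
    ext i
    by_cases h : a ≤ (i : ℕ) ∧ (i : ℕ) < a + b <;> simp [h]
  map_smul' c y := by
    ext i
    by_cases h : a ≤ (i : ℕ) ∧ (i : ℕ) < a + b <;> simp [h]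

/-- The window of length `b` at offset `a` of a vector of length `m`. -/
def window (F : Type*) [Field F] (m a b : ℕ) : (Fin m → F) →ₗ[F] (Fin b → F) where
  toFun x i := if h : a + (i : ℕ) < m then x ⟨a + i, h⟩ else 0
  map_add' y y' := by
    ext i
    by_cases h : a + (i : ℕ) < m <;> simp [h]
  map_smul' c y := by
    ext i
    by_cases h : a + (i : ℕ) < m <;> simp [h]

theorem place_apply {m a b : ℕ} (y : Fin b → F) (i : Fin m) :
    place F m a b y i =
      if h : a ≤ (i : ℕ) ∧ (i : ℕ) < a + b then y ⟨i - a, by omega⟩ else 0 := rfl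

theorem window_apply {m a b : ℕ} (x : Fin m → F) (i : Fin b) :
    window F m a b x i = if h : a + (i : ℕ) < m then x ⟨a + i, h⟩ else 0 := rfl

theorem window_place_self {m a b : ℕ} (h : a + b ≤ m) (y : Fin b → F) :
    window F m a b (place F m a b y) = y := by
  ext i
  have hi := i.2
  rw [window_apply, dif_pos (by omega), place_apply, dif_pos ⟨by simp, by simp⟩]
  congr 1
  ext
  simp

theorem window_place_of_disjoint {m a b a' b' : ℕ} (h : a + b ≤ a' ∨ a' + b' ≤ a)
    (y : Fin b' → F) : window F m a b (place F m a' b' y) = 0 := by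
  ext i
  have hi := i.2
  rw [window_apply]
  split_ifs with h1
  · rw [place_apply, dif_neg]
    · rfl
    · simp only
      omega
  · rfl

theorem coprod_place_injective {m a b a' b' : ℕ} (h : a + b ≤ m) (h' : a' + b' ≤ m)
    (hd : a + b ≤ a' ∨ a' + b' ≤ a) :
    Function.Injective ((place F m a b).coprod (place F m a' b')) := by
  intro x y hxy
  have h1 := congrArg (window F m a b) hxy
  have h2 := congrArg (window F m a' b') hxy
  simp only [LinearMap.coprod_apply, map_add, window_place_self h, window_place_self h',
    window_place_of_disjoint hd, window_place_of_disjoint hd.symm, add_zero, zero_add] at h1 h2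
  exact Prod.ext h1 h2

/-- The map with matrix `(0 | I | M)`, where the zero block has `i * δ` columns. -/
def blockMap (m δ ω i : ℕ) (M : (Fin ω → F) →ₗ[F] (Fin (m - ω - i * δ) → F)) :
    (Fin ω → F) →ₗ[F] (Fin m → F) :=
  (place F m (i * δ) ω).coprod (place F m (i * δ + ω) (m - ω - i * δ)) ∘ₗ
    LinearMap.id.prod M

variable {m δ ω : ℕ}

theorem blockMap_apply {i : ℕ} (M : (Fin ω → F) →ₗ[F] (Fin (m - ω - i * δ) → F))
    (x : Fin ω → F) : blockMap m δ ω i M x =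
      place F m (i * δ) ω x + place F m (i * δ + ω) (m - ω - i * δ) (M x) := rfl

theorem blockMap_injective {i : ℕ} (h : i * δ + ω ≤ m)
    (M : (Fin ω → F) →ₗ[F] (Fin (m - ω - i * δ) → F)) :
    Function.Injective (blockMap m δ ω i M) := by
  refine (coprod_place_injective h (by omega) (Or.inl le_rfl)).comp fun x y hxy => ?_
  exact (Prod.ext_iff.1 hxy).1

theorem finrank_range_blockMap_inf_add_le {i : ℕ} (h : i * δ + ω ≤ m)
    (M M' : (Fin ω → F) →ₗ[F] (Fin (m - ω - i * δ) → F)) :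
    finrank F (LinearMap.range (blockMap m δ ω i M) ⊓ LinearMap.range (blockMap m δ ω i M') :
      Submodule F (Fin m → F)) + finrank F (LinearMap.range (M - M')) ≤ ω := by
  have := finrank_liftWord_inf_add_le (g := LinearMap.id) M M'
    (coprod_place_injective (F := F) (m := m) h (by omega : i * δ + ω + (m - ω - i * δ) ≤ m)
      (Or.inl le_rfl)) Function.injective_id
  rw [finrank_fin_fun] at this
  exact this

/-- The `δ` coordinates starting at `i * δ` vanish on the block with the larger offset. The other
block has part of its identity there and projects onto all of them, so the intersection loses `δ`
dimensions. -/
theorem finrank_range_blockMap_inf_add_le_of_lt {i i' : ℕ} (hi : i < i') (h : i' * δ + ω ≤ m)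
    (hδ : δ ≤ ω) (M : (Fin ω → F) →ₗ[F] (Fin (m - ω - i * δ) → F))
    (M' : (Fin ω → F) →ₗ[F] (Fin (m - ω - i' * δ) → F)) :
    finrank F (LinearMap.range (blockMap m δ ω i M) ⊓ LinearMap.range (blockMap m δ ω i' M') :
      Submodule F (Fin m → F)) + δ ≤ ω := by
  have hii : i * δ + δ ≤ i' * δ := by
    have := Nat.mul_le_mul_right δ (Nat.succ_le_of_lt hi)
    rwa [Nat.succ_mul] at this
  have h1 : LinearMap.range (blockMap m δ ω i' M') ≤
      LinearMap.ker (window F m (i * δ) δ) := by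
    rintro _ ⟨x, rfl⟩
    rw [LinearMap.mem_ker, blockMap_apply, map_add, window_place_of_disjoint (Or.inl hii), window_place_of_disjoint (by omega), add_zero]
  have h2 : (LinearMap.range (blockMap m δ ω i M)).map (window F m (i * δ) δ) = ⊤ := by
    rw [eq_top_iff]
    intro y _
    refine ⟨_, ⟨place F ω 0 δ y, rfl⟩, ?_⟩
    rw [blockMap_apply, map_add, window_place_of_disjoint (a' := i * δ + ω) (by omega), add_zero]
    ext j
    have hj := j.2
    rw [window_apply, dif_pos (by omega), place_apply, dif_pos ⟨by simp, by simp; omega⟩,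
      place_apply, dif_pos (by simp)]
    congr 1
    ext
    simp
  have h3 := finrank_map_add_finrank_inf_ker (window F m (i * δ) δ)
    (LinearMap.range (blockMap m δ ω i M))
  rw [h2, finrank_top, finrank_fin_fun,
    LinearMap.finrank_range_of_inj (blockMap_injective (by omega) M), finrank_fin_fun] at h3
  have h4 := Submodule.finrank_mono (inf_le_inf_left (LinearMap.range (blockMap m δ ω i M)) h1)
  omega

end Windows

/-! ### Labelling cosets in nested MRD codes. -/

section CosetLabels

open Module

variable {F : Type*} [Field F] [Fintype F]

/-- Translates of the smaller code of a nested family at mutual rank distance at least `d`. -/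
theorem exists_coset_labels {a b d δ N : ℕ}
    {G : ℕ → AddSubgroup ((Fin a → F) →ₗ[F] (Fin b → F))} (hG : Antitone G)
    (hcard : ∀ d, 1 ≤ d → d ≤ min a b → Nat.card (G d) = mrdSize (Fintype.card F) a b d)
    (hrank : ∀ d, ∀ A ∈ G d, A ≠ 0 → d ≤ finrank F (LinearMap.range A))
    (hd : d ≤ δ) (hδ : δ ≤ min a b) (hN : N ≤ Fintype.card F ^ (max a b * (δ - d))) :
    ∃ s : Fin N → ((Fin a → F) →ₗ[F] (Fin b → F)), ∀ l l', l ≠ l' → ∀ A ∈ G δ, ∀ A' ∈ G δ,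
      d ≤ finrank F (LinearMap.range ((s l + A) - (s l' + A'))) := by
  -- The size formula for `G d` starts at `d = 1`. Distance `0` demands nothing, so all labels may
  -- be the zero map; this happens for `δ = 1`.
  rcases Nat.eq_zero_or_pos d with rfl | hd0
  · exact ⟨0, fun _ _ _ _ _ _ _ => Nat.zero_le _⟩
  have hfin : Finite ((Fin a → F) →ₗ[F] (Fin b → F)) := Module.finite_of_finite F
  have hle : G δ ≤ G d := hG hd
  have hidx : Nat.card (G d ⧸ (G δ).addSubgroupOf (G d)) =
      Fintype.card F ^ (max a b * (δ - d)) := by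
    have h1 := AddSubgroup.card_eq_card_quotient_mul_card_addSubgroup ((G δ).addSubgroupOf (G d))
    rw [Nat.card_congr (AddSubgroup.addSubgroupOfEquivOfLe hle).toEquiv, hcard d hd0 (hd.trans hδ),
      hcard δ (hd0.trans_le hd) hδ, mrdSize, mrdSize] at h1
    have h2 : max a b * (min a b + 1 - d) =
        max a b * (δ - d) + max a b * (min a b + 1 - δ) := by
      rw [← mul_add]
      congr 1
      omega
    rw [h2, pow_add] at h1
    exact (Nat.eq_of_mul_eq_mul_right (pow_pos Fintype.card_pos _) h1).symm
  have hfq : Fintype (G d ⧸ (G δ).addSubgroupOf (G d)) := Fintype.ofFinite _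
  have hNq : N ≤ Fintype.card (G d ⧸ (G δ).addSubgroupOf (G d)) := by
    rwa [← Nat.card_eq_fintype_card, hidx]
  let t : Fin N → G d ⧸ (G δ).addSubgroupOf (G d) := fun l =>
    (Fintype.equivFin _).symm (Fin.castLE hNq l)
  have ht : Function.Injective t :=
    (Fintype.equivFin _).symm.injective.comp (Fin.castLE_injective hNq)
  refine ⟨fun l => ((t l).out : G d).1, fun l l' hll A hA A' hA' => ?_⟩
  -- The difference lies in `G d`. Were it zero, the two representatives would differ by an element
  -- of `G δ` and the cosets would coincide.
  refine hrank d _ ?_ fun h0 => hll (ht ?_)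
  · exact (G d).sub_mem ((G d).add_mem (Subtype.prop _) (hle hA))
      ((G d).add_mem (Subtype.prop _) (hle hA'))
  · rw [← QuotientAddGroup.out_eq' (t l), ← QuotientAddGroup.out_eq' (t l'), QuotientAddGroup.eq,
      AddSubgroup.mem_addSubgroupOf]
    have h1 : ((-(t l).out + (t l').out : G d) : (Fin a → F) →ₗ[F] (Fin b → F)) = A - A' := by
      rw [AddSubgroup.coe_add, AddSubgroup.coe_neg]
      have h2 := sub_eq_zero.1 h0
      rw [neg_add_eq_iff_eq_add, add_sub, eq_sub_iff_add_eq]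
      exact h2.symm
    rw [h1]
    exact (G δ).sub_mem hA hA'

end CosetLabels

/-! ### Gluing pairs of subspaces by a rank restricted code. -/

section PairedFamily

open Module

variable {F : Type*} [Field F]

theorem exists_injective_range_inf_eq_bot {Y : Type*} [AddCommGroup Y] [Module F Y]
    [FiniteDimensional F Y] (Q : Submodule F Y) {c : ℕ} (h : finrank F Q + c ≤ finrank F Y) :
    ∃ β : (Fin c → F) →ₗ[F] Y, Function.Injective β ∧ Q ⊓ LinearMap.range β = ⊥ := by
  obtain ⟨R, hR⟩ := Submodule.exists_isCompl Q
  have h1 := Submodule.finrank_add_eq_of_isCompl hR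
  obtain ⟨P, hPR, hP⟩ := exists_le_finrank_eq R (d := c) (by omega)
  let e : (Fin c → F) ≃ₗ[F] P := LinearEquiv.ofFinrankEq _ _ (by simp [hP])
  refine ⟨P.subtype ∘ₗ e.toLinearMap, P.injective_subtype.comp e.injective, ?_⟩
  rw [LinearMap.range_comp, LinearEquiv.range, Submodule.map_top, Submodule.range_subtype]
  exact (hR.disjoint.mono_right hPR).eq_bot

/-- The words `{(u, v + β B u)}` built from pairs of subspaces and a rank restricted code. -/
theorem exists_paired_family {Y₁ Y₂ V : Type*} [AddCommGroup Y₁] [Module F Y₁]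
    [FiniteDimensional F Y₁] [AddCommGroup Y₂] [Module F Y₂] [FiniteDimensional F Y₂]
    [AddCommGroup V] [Module F V] [FiniteDimensional F V] (Ψ : Y₁ × Y₂ →ₗ[F] V)
    (hΨ : Function.Injective Ψ) (ρ : V →ₗ[F] Y₁) (hρ : ∀ p, ρ (Ψ p) = p.1)
    {I : Type*} {w₁ w₂ c δ : ℕ} (hδ : 0 < δ)
    (e : I → (Fin w₁ → F) →ₗ[F] Y₁) (v : I → (Fin w₂ → F) →ₗ[F] Y₂)
    (he : ∀ p, Function.Injective (e p)) (hv : ∀ p, Function.Injective (v p))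
    (hev : ∀ p p', p ≠ p' →
      finrank F (LinearMap.range (e p) ⊓ LinearMap.range (e p') : Submodule F Y₁) +
        finrank F (LinearMap.range (v p) ⊓ LinearMap.range (v p') : Submodule F Y₂) + δ ≤ w₁ + w₂)
    (hc : w₂ + c ≤ finrank F Y₂) (C : Set ((Fin w₁ → F) →ₗ[F] (Fin c → F)))
    (hC : ∀ M ∈ C, ∀ M' ∈ C, M ≠ M' → δ ≤ finrank F (LinearMap.range (M - M')))
    (hCr : ∀ M ∈ C, finrank F (LinearMap.range M) + δ ≤ w₁)
    (K₁ K₂ : Submodule F V) (hK₁ : ∀ y, Ψ (0, y) ∈ K₁) (hK₂ : ∀ y, Ψ (y, 0) ∈ K₂) :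
    ∃ S : Set (Submodule F V), S.ncard = Nat.card I * Nat.card C ∧
      (∀ W ∈ S, finrank F W = w₁ + w₂) ∧
      (∀ W ∈ S, ∀ W' ∈ S, W ≠ W' → finrank F (W ⊓ W' : Submodule F V) + δ ≤ w₁ + w₂) ∧
      ∀ W ∈ S, w₂ ≤ finrank F (W ⊓ K₁ : Submodule F V) ∧
        δ ≤ finrank F (W ⊓ K₂ : Submodule F V) := by
  have hvr : ∀ p, finrank F (LinearMap.range (v p)) = w₂ := fun p => by
    rw [LinearMap.finrank_range_of_inj (hv p), finrank_fin_fun]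
  -- `β p` places the columns of `M` in a complement of the range of `v p`. It may depend
  -- arbitrarily on `p`, since words with different `p` are compared without it.
  choose β hβ hβv using fun p => exists_injective_range_inf_eq_bot (LinearMap.range (v p))
    (c := c) ((hvr p).symm ▸ hc)
  have hvβ : ∀ p, Function.Injective ((v p).coprod (β p)) := by
    intro p
    rw [← LinearMap.ker_eq_bot, eq_bot_iff]
    rintro ⟨z, w⟩ hx
    have h1 : v p z + β p w = 0 := by simpa using hx
    have h2 : v p z ∈ LinearMap.range (v p) ⊓ LinearMap.range (β p) :=
      ⟨⟨z, rfl⟩, ⟨-w, by rw [map_neg]; exact (eq_neg_of_add_eq_zero_left h1).symm⟩⟩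
    rw [hβv, Submodule.mem_bot] at h2
    have hz : z = 0 := hv p (h2.trans (map_zero _).symm)
    rw [h2, zero_add] at h1
    have hw : w = 0 := hβ p (h1.trans (map_zero _).symm)
    rw [hz, hw]
    exact Submodule.zero_mem _
  -- Grouping the `v`-coordinate with `Y₁` exhibits the words with fixed `p` as lifts by `M` of one
  -- fixed generator map, so rank distance applies.
  let Φ : I → (Y₁ × (Fin w₂ → F)) × (Fin c → F) →ₗ[F] V := fun p =>
    Ψ ∘ₗ ((LinearMap.id.prodMap ((v p).coprod (β p))) ∘ₗ
      (LinearEquiv.prodAssoc F Y₁ (Fin w₂ → F) (Fin c → F)).toLinearMap)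
  have hΦapp : ∀ p y z w, Φ p ((y, z), w) = Ψ (y, v p z + β p w) := fun p y z w => rfl
  have hΦ : ∀ p, Function.Injective (Φ p) := by
    intro p
    rintro ⟨⟨y, z⟩, w⟩ ⟨⟨y', z'⟩, w'⟩ h
    have h1 := Prod.ext_iff.1 (hΨ h)
    have h2 := Prod.ext_iff.1 (@hvβ p (z, w) (z', w') h1.2)
    exact Prod.ext (Prod.ext h1.1 h2.1) h2.2
  let g : I → (Fin w₁ → F) × (Fin w₂ → F) →ₗ[F] Y₁ × (Fin w₂ → F) := fun p =>
    (e p).prodMap LinearMap.id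
  have hg : ∀ p, Function.Injective (g p) := fun p =>
    Function.Injective.prodMap (he p) Function.injective_id
  let π : (Fin w₁ → F) × (Fin w₂ → F) →ₗ[F] (Fin w₁ → F) := LinearMap.fst F _ _
  have hπ : ∀ M : (Fin w₁ → F) →ₗ[F] (Fin c → F),
      LinearMap.range (M ∘ₗ π) = LinearMap.range M := fun M =>
    LinearMap.range_comp_of_range_eq_top M (LinearMap.range_eq_top.2 Prod.fst_surjective)
  let word : I × C → Submodule F V := fun p => liftWord (Φ p.1) (g p.1) (p.2.1 ∘ₗ π)
  have hmem : ∀ p w, w ∈ word p → ∃ x z, Ψ (e p.1 x, v p.1 z + β p.1 (p.2.1 x)) = w := by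
    rintro p w ⟨x, rfl⟩
    exact ⟨x.1, x.2, rfl⟩
  have hmem' : ∀ p z, Ψ (0, v p.1 z) ∈ word p := by
    intro p z
    refine ⟨(0, z), ?_⟩
    have h1 : (Φ p.1) ((e p.1 0, z), p.2.1 0) = Ψ (0, v p.1 z) := by
      rw [hΦapp, map_zero, map_zero, map_zero, add_zero]
    exact h1
  have hfrD : finrank F ((Fin w₁ → F) × (Fin w₂ → F)) = w₁ + w₂ := by simp
  have hdim : ∀ p, finrank F (word p) = w₁ + w₂ := fun p => by
    simp only [word]
    rw [finrank_liftWord _ (hΦ p.1) (hg p.1), hfrD]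
  have hdist : ∀ p p', p ≠ p' →
      finrank F (word p ⊓ word p' : Submodule F V) + δ ≤ w₁ + w₂ := by
    intro p p' hne
    by_cases hp : p.1 = p'.1
    · obtain ⟨i, M⟩ := p
      obtain ⟨i', M'⟩ := p'
      obtain rfl : i = i' := hp
      have hM : M.1 ≠ M'.1 := fun h => hne (by rw [Subtype.ext h])
      have h1 := hC M.1 M.2 M'.1 M'.2 hM
      have h2 := finrank_liftWord_inf_add_le (M.1 ∘ₗ π) (M'.1 ∘ₗ π) (hΦ i) (hg i)
      rw [hfrD, ← LinearMap.sub_comp, hπ] at h2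
      simp only [word]
      omega
    · have h1 := hev p.1 p'.1 hp
      have h2 := finrank_inf_le_of_map ρ (word p) (word p')
      have h3 : ∀ p, (word p).map ρ ≤ LinearMap.range (e p.1) := by
        rintro p _ ⟨w, hw, rfl⟩
        obtain ⟨x, z, rfl⟩ := hmem p w hw
        rw [hρ]
        exact ⟨x, rfl⟩
      have h4 := Submodule.finrank_mono (inf_le_inf (h3 p) (h3 p'))
      -- A vanishing first component kills `x`, and with it the glue term; hence the part of a word
      -- in `ker ρ` is just a copy of the range of `v`.
      have h5 : ∀ p w, w ∈ word p → ρ w = 0 → ∃ z, Ψ (0, v p.1 z) = w := by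
        intro p w hw h0
        obtain ⟨x, z, rfl⟩ := hmem p w hw
        rw [hρ] at h0
        have hx : x = 0 := he p.1 ((h0 : e p.1 x = 0).trans (map_zero _).symm)
        exact ⟨z, by rw [hx, map_zero, map_zero, map_zero, add_zero]⟩
      have h6 : word p ⊓ word p' ⊓ LinearMap.ker ρ ≤
          (LinearMap.range (v p.1) ⊓ LinearMap.range (v p'.1)).map (Ψ ∘ₗ LinearMap.inr F Y₁ Y₂) := by
        rintro w ⟨⟨hw, hw'⟩, h0⟩
        obtain ⟨z, rfl⟩ := h5 p w hw h0
        obtain ⟨z', hz'⟩ := h5 p' _ hw' h0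
        exact ⟨v p.1 z, ⟨⟨z, rfl⟩, ⟨z', (Prod.ext_iff.1 (hΨ hz')).2⟩⟩, rfl⟩
      have h7 := (Submodule.finrank_mono h6).trans (Submodule.finrank_map_le _ _)
      omega
  have hinj : Function.Injective word := by
    intro p p' h
    by_contra hne
    have h1 := hdist p p' hne
    rw [← h, inf_idem, hdim] at h1
    omega
  refine ⟨Set.range word, ?_, ?_, ?_, ?_⟩
  · rw [← Nat.card_coe_set_eq, Nat.card_range_of_injective hinj, Nat.card_prod]
  · rintro _ ⟨p, rfl⟩
    exact hdim p
  · rintro _ ⟨p, rfl⟩ _ ⟨p', rfl⟩ hne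
    exact hdist p p' (fun h => hne (congrArg word h))
  · rintro _ ⟨p, rfl⟩
    constructor
    · have h1 : LinearMap.range (Ψ ∘ₗ LinearMap.inr F Y₁ Y₂ ∘ₗ v p.1) ≤ word p ⊓ K₁ := by
        rintro _ ⟨z, rfl⟩
        exact ⟨hmem' p z, hK₁ _⟩
      have h2 := Submodule.finrank_mono h1
      rwa [LinearMap.finrank_range_of_inj, finrank_fin_fun] at h2
      exact hΨ.comp (LinearMap.inr_injective.comp (hv p.1))
    · have h1 : LinearMap.range (Ψ ∘ₗ LinearMap.inl F Y₁ Y₂ ∘ₗ e p.1 ∘ₗ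
          (LinearMap.ker p.2.1).subtype) ≤ word p ⊓ K₂ := by
        rintro _ ⟨x, rfl⟩
        refine ⟨⟨(x.1, 0), ?_⟩, hK₂ _⟩
        have h3 : p.2.1 x.1 = 0 := x.2
        have h4 : (Φ p.1) ((e p.1 x.1, 0), p.2.1 x.1) = Ψ (e p.1 x.1, 0) := by
          rw [hΦapp, h3, map_zero, map_zero, add_zero]
        exact h4
      have h2 := Submodule.finrank_mono h1
      rw [LinearMap.finrank_range_of_inj] at h2
      · have h3 := p.2.1.finrank_range_add_finrank_ker
        have h4 := hCr p.2.1 p.2.2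
        rw [finrank_fin_fun] at h3
        omega
      · exact hΨ.comp (LinearMap.inl_injective.comp ((he p.1).comp
          (Submodule.injective_subtype _)))

end PairedFamily

/-! ### Placements of several blocks, and the two remaining ingredients of the code. -/

section Assembly

open Module

variable {F : Type*} [Field F]

theorem window_eq_zero_of_window_eq_zero {m a b c d : ℕ} {x : Fin m → F}
    (hx : window F m c d x = 0) (h : c ≤ a) (h' : a + b ≤ c + d) : window F m a b x = 0 := by
  ext i
  have hi := i.2
  rw [window_apply]
  split_ifs with h1
  · have h2 := congrFun hx ⟨a + i - c, by omega⟩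
    rw [window_apply, dif_pos (by simp only; omega)] at h2
    refine Eq.trans ?_ h2
    congr 1
    ext
    simp only
    omega
  · rfl

theorem window_coprod_place_fst {m a b a' b' : ℕ} (h : a + b ≤ m)
    (hd : a + b ≤ a' ∨ a' + b' ≤ a) (p : (Fin b → F) × (Fin b' → F)) :
    window F m a b ((place F m a b).coprod (place F m a' b') p) = p.1 := by
  rw [LinearMap.coprod_apply, map_add, window_place_self h, window_place_of_disjoint hd, add_zero]

/-- Placement of three vectors at disjoint positions. -/
def placeThree (F : Type*) [Field F] (m a b a' b' a'' b'' : ℕ) :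
    ((Fin b → F) × (Fin b' → F)) × (Fin b'' → F) →ₗ[F] (Fin m → F) :=
  ((place F m a b).coprod (place F m a' b')).coprod (place F m a'' b'')

theorem placeThree_apply {m a b a' b' a'' b'' : ℕ}
    (p : ((Fin b → F) × (Fin b' → F)) × (Fin b'' → F)) :
    placeThree F m a b a' b' a'' b'' p =
      place F m a b p.1.1 + place F m a' b' p.1.2 + place F m a'' b'' p.2 := rfl

variable {m a b a' b' a'' b'' : ℕ}

theorem window_placeThree_one (h : a + b ≤ m) (h₁ : a + b ≤ a' ∨ a' + b' ≤ a)
    (h₂ : a + b ≤ a'' ∨ a'' + b'' ≤ a) (p : ((Fin b → F) × (Fin b' → F)) × (Fin b'' → F)) :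
    window F m a b (placeThree F m a b a' b' a'' b'' p) = p.1.1 := by
  rw [placeThree_apply, map_add, map_add, window_place_self h, window_place_of_disjoint h₁,
    window_place_of_disjoint h₂, add_zero, add_zero]

theorem window_placeThree_two (h : a' + b' ≤ m) (h₁ : a + b ≤ a' ∨ a' + b' ≤ a)
    (h₂ : a' + b' ≤ a'' ∨ a'' + b'' ≤ a') (p : ((Fin b → F) × (Fin b' → F)) × (Fin b'' → F)) :
    window F m a' b' (placeThree F m a b a' b' a'' b'' p) = p.1.2 := by
  rw [placeThree_apply, map_add, map_add, window_place_self h, window_place_of_disjoint h₁.symm,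
    window_place_of_disjoint h₂, add_zero, zero_add]

theorem window_placeThree_three (h : a'' + b'' ≤ m) (h₁ : a + b ≤ a'' ∨ a'' + b'' ≤ a)
    (h₂ : a' + b' ≤ a'' ∨ a'' + b'' ≤ a') (p : ((Fin b → F) × (Fin b' → F)) × (Fin b'' → F)) :
    window F m a'' b'' (placeThree F m a b a' b' a'' b'' p) = p.2 := by
  rw [placeThree_apply, map_add, map_add, window_place_self h, window_place_of_disjoint h₁.symm,
    window_place_of_disjoint h₂.symm, zero_add, zero_add]

theorem placeThree_injective (h : a + b ≤ m) (h' : a' + b' ≤ m) (h'' : a'' + b'' ≤ m)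
    (h₁ : a + b ≤ a' ∨ a' + b' ≤ a) (h₂ : a + b ≤ a'' ∨ a'' + b'' ≤ a)
    (h₃ : a' + b' ≤ a'' ∨ a'' + b'' ≤ a') :
    Function.Injective (placeThree F m a b a' b' a'' b'') := by
  intro x y hxy
  have e1 := congrArg (window F m a b) hxy
  have e2 := congrArg (window F m a' b') hxy
  have e3 := congrArg (window F m a'' b'') hxy
  rw [window_placeThree_one h h₁ h₂, window_placeThree_one h h₁ h₂] at e1
  rw [window_placeThree_two h' h₁ h₃, window_placeThree_two h' h₁ h₃] at e2
  rw [window_placeThree_three h'' h₂ h₃, window_placeThree_three h'' h₂ h₃] at e3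
  exact Prod.ext (Prod.ext e1 e2) e3

/-- A rank restricted code consisting of the maps of rank at most `r` in an MRD code. -/
theorem exists_rank_restricted_code (F : Type*) [Field F] [Fintype F] {a b δ r : ℕ} (hab : a ≤ b)
    (hδ : 1 ≤ δ) (hδa : δ ≤ a) (hr : r ≤ a) :
    ∃ C : Set ((Fin a → F) →ₗ[F] (Fin b → F)),
      (Nat.card C : ℚ) = rrmcSize (Fintype.card F) a b δ r ∧
      (∀ M ∈ C, ∀ M' ∈ C, M ≠ M' → δ ≤ finrank F (LinearMap.range (M - M'))) ∧
      ∀ M ∈ C, finrank F (LinearMap.range M) ≤ r := by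
  obtain ⟨G, -, hcard, hrank⟩ := exists_mrd F a b
  refine ⟨{M | M ∈ G δ ∧ finrank F (LinearMap.range M) ≤ r}, ?_, ?_, fun M hM => hM.2⟩
  · have h1 := natCard_finrank_range_le_of_mrd (G δ) (r := r) (by simpa using hab) hδ
      (by simpa using hr) (by
        rw [hcard δ hδ (le_min hδa (hδa.trans hab)), mrdSize, min_eq_left hab, max_eq_right hab,
          finrank_fin_fun, finrank_fin_fun]) (hrank δ)
    rw [finrank_fin_fun, finrank_fin_fun] at h1
    rw [← h1]
    congr 1
    exact Nat.card_congr (Equiv.subtypeSubtypeEquivSubtypeInter (· ∈ G δ)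
      (fun M => finrank F (LinearMap.range M) ≤ r)).symm
  · intro M hM M' hM' hne
    exact hrank δ _ ((G δ).sub_mem hM.1 hM'.1) (sub_ne_zero.2 hne)

/-- The words built from pairs of blocks `(0 | I | M₁)`, `(0 | I | M₃)` with `(M₁, M₃)` in matched
cosets, and from a rank restricted code. -/
theorem exists_block_family [Fintype F] {n μ m δ ω₁ ω₂ c θ₁ θ₂ : ℕ} (hn : μ + m = n) (hδ : 0 < δ)
    (hω₁ : δ ≤ ω₁) (hω₂ : δ ≤ ω₂) (hθ₁ : θ₁ * δ + δ + ω₁ ≤ μ) (hθ₂ : θ₂ * δ + δ + ω₂ ≤ m)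
    (d : ℕ → ℕ → ℕ) (hd : ∀ i ≤ θ₁, ∀ j ≤ θ₂, d i j ≤ δ) (hc : ω₂ + c ≤ m)
    (C : Set ((Fin ω₁ → F) →ₗ[F] (Fin c → F)))
    (hC : ∀ M ∈ C, ∀ M' ∈ C, M ≠ M' → δ ≤ finrank F (LinearMap.range (M - M')))
    (hCr : ∀ M ∈ C, finrank F (LinearMap.range M) + δ ≤ ω₁)
    (K₁ K₂ : Submodule F (Fin n → F)) (hK₁ : ∀ y, place F n μ m y ∈ K₁)
    (hK₂ : ∀ y, place F n 0 μ y ∈ K₂) :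
    ∃ S : Set (Submodule F (Fin n → F)), S.ncard =
      (∑ i ∈ Finset.range (θ₁ + 1), ∑ j ∈ Finset.range (θ₂ + 1),
        Fintype.card F ^ min (max ω₁ (μ - ω₁ - i * δ) * (δ - d i j))
          (max ω₂ (m - ω₂ - j * δ) * d i j) *
        (mrdSize (Fintype.card F) ω₁ (μ - ω₁ - i * δ) δ *
          mrdSize (Fintype.card F) ω₂ (m - ω₂ - j * δ) δ)) * Nat.card C ∧
      (∀ W ∈ S, finrank F W = ω₁ + ω₂) ∧
      (∀ W ∈ S, ∀ W' ∈ S, W ≠ W' →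
        finrank F (W ⊓ W' : Submodule F (Fin n → F)) + δ ≤ ω₁ + ω₂) ∧
      ∀ W ∈ S, ω₂ ≤ finrank F (W ⊓ K₁ : Submodule F (Fin n → F)) ∧
        δ ≤ finrank F (W ⊓ K₂ : Submodule F (Fin n → F)) := by
  have hmul : ∀ {i θ : ℕ}, i ≤ θ → i * δ ≤ θ * δ := fun h => Nat.mul_le_mul_right δ h
  choose G hG hGc hGr using fun i => exists_mrd F ω₁ (μ - ω₁ - i * δ)
  choose H hH hHc hHr using fun j => exists_mrd F ω₂ (m - ω₂ - j * δ)
  have hμi : ∀ i ≤ θ₁, i * δ + δ + ω₁ ≤ μ := fun i hi => by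
    have := hmul hi
    omega
  have hmj : ∀ j ≤ θ₂, j * δ + δ + ω₂ ≤ m := fun j hj => by
    have := hmul hj
    omega
  -- The number of common labels is the smaller of the two coset counts: distance `d` on the left
  -- gives exponent factor `δ - d`, distance `δ - d` on the right gives `d`.
  let N : ℕ → ℕ → ℕ := fun i j => Fintype.card F ^
    min (max ω₁ (μ - ω₁ - i * δ) * (δ - d i j)) (max ω₂ (m - ω₂ - j * δ) * d i j)
  have hlab : ∀ (i : Fin (θ₁ + 1)) (j : Fin (θ₂ + 1)),
      ∃ s : Fin (N i j) → ((Fin ω₁ → F) →ₗ[F] (Fin (μ - ω₁ - i * δ) → F)),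
        ∀ l l', l ≠ l' → ∀ A ∈ G i δ, ∀ A' ∈ G i δ,
          d i j ≤ finrank F (LinearMap.range ((s l + A) - (s l' + A'))) := fun i j =>
    exists_coset_labels (hG i) (hGc i) (hGr i)
      (hd i (Nat.lt_succ_iff.1 i.2) j (Nat.lt_succ_iff.1 j.2))
      (by have := hμi i (Nat.lt_succ_iff.1 i.2); omega)
      (Nat.pow_le_pow_right Fintype.card_pos (min_le_left _ _))
  have hlab' : ∀ (i : Fin (θ₁ + 1)) (j : Fin (θ₂ + 1)),
      ∃ s : Fin (N i j) → ((Fin ω₂ → F) →ₗ[F] (Fin (m - ω₂ - j * δ) → F)),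
        ∀ l l', l ≠ l' → ∀ A ∈ H j δ, ∀ A' ∈ H j δ,
          δ - d i j ≤ finrank F (LinearMap.range ((s l + A) - (s l' + A'))) := fun i j =>
    exists_coset_labels (hH j) (hHc j) (hHr j) (Nat.sub_le _ _)
      (by have := hmj j (Nat.lt_succ_iff.1 j.2); omega)
      (Nat.pow_le_pow_right Fintype.card_pos (by
        rw [Nat.sub_sub_self (hd i (Nat.lt_succ_iff.1 i.2) j (Nat.lt_succ_iff.1 j.2))]
        exact min_le_right _ _))
  choose s hs using hlab
  choose s' hs' using hlab'
  let I := Σ p : Fin (θ₁ + 1) × Fin (θ₂ + 1), Fin (N p.1 p.2) × (G p.1 δ × H p.2 δ)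
  let e : I → (Fin ω₁ → F) →ₗ[F] (Fin μ → F) := fun x =>
    blockMap μ δ ω₁ x.1.1 (s x.1.1 x.1.2 x.2.1 + x.2.2.1.1)
  let v : I → (Fin ω₂ → F) →ₗ[F] (Fin m → F) := fun x =>
    blockMap m δ ω₂ x.1.2 (s' x.1.1 x.1.2 x.2.1 + x.2.2.2.1)
  have hle₁ : ∀ i : Fin (θ₁ + 1), (i : ℕ) * δ + ω₁ ≤ μ := fun i => by
    have := hμi i (Nat.lt_succ_iff.1 i.2)
    omega
  have hle₂ : ∀ j : Fin (θ₂ + 1), (j : ℕ) * δ + ω₂ ≤ m := fun j => by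
    have := hmj j (Nat.lt_succ_iff.1 j.2)
    omega
  have he : ∀ x, Function.Injective (e x) := fun x => blockMap_injective (hle₁ _) _
  have hv : ∀ x, Function.Injective (v x) := fun x => blockMap_injective (hle₂ _) _
  have her : ∀ x, finrank F (LinearMap.range (e x)) = ω₁ := fun x => by
    rw [LinearMap.finrank_range_of_inj (he x), finrank_fin_fun]
  have hvr : ∀ x, finrank F (LinearMap.range (v x)) = ω₂ := fun x => by
    rw [LinearMap.finrank_range_of_inj (hv x), finrank_fin_fun]
  have hev : ∀ x y, x ≠ y →
      finrank F (LinearMap.range (e x) ⊓ LinearMap.range (e y) : Submodule F (Fin μ → F)) +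
        finrank F (LinearMap.range (v x) ⊓ LinearMap.range (v y) : Submodule F (Fin m → F)) + δ ≤
          ω₁ + ω₂ := by
    intro x y hxy
    have h1 := Submodule.finrank_mono
      (inf_le_left : LinearMap.range (e x) ⊓ LinearMap.range (e y) ≤ _)
    have h2 := Submodule.finrank_mono
      (inf_le_left : LinearMap.range (v x) ⊓ LinearMap.range (v y) ≤ _)
    rw [her] at h1
    rw [hvr] at h2
    by_cases hi : x.1.1 = y.1.1
    · by_cases hj : x.1.2 = y.1.2
      · obtain ⟨⟨i, j⟩, l, A, B⟩ := x
        obtain ⟨⟨i', j'⟩, l', A', B'⟩ := y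
        obtain rfl : i = i' := hi
        obtain rfl : j = j' := hj
        have h3 := finrank_range_blockMap_inf_add_le (hle₁ i) (s i j l + A.1) (s i j l' + A'.1)
        have h4 := finrank_range_blockMap_inf_add_le (hle₂ j) (s' i j l + B.1) (s' i j l' + B'.1)
        simp only [e, v]
        -- Equal labels: one of the two code components differs and alone provides `δ`. Different
        -- labels: the two sides provide `d` and `δ - d`.
        by_cases hl : l = l'
        · subst hl
          rw [add_sub_add_left_eq_sub] at h3 h4
          by_cases hA : A = A'
          · have hB : B.1 ≠ B'.1 := fun h => hxy (by rw [hA, Subtype.ext h])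
            have := hHr j δ _ ((H j δ).sub_mem B.2 B'.2) (sub_ne_zero.2 hB)
            omega
          · have := hGr i δ _ ((G i δ).sub_mem A.2 A'.2)
              (sub_ne_zero.2 fun h => hA (Subtype.ext h))
            omega
        · have h5 := hs i j l l' hl A.1 A.2 A'.1 A'.2
          have h6 := hs' i j l l' hl B.1 B.2 B'.1 B'.2
          omega
      · rcases Nat.lt_or_gt_of_ne (fun h => hj (Fin.ext h)) with hlt | hlt
        · have := finrank_range_blockMap_inf_add_le_of_lt hlt (hle₂ y.1.2) hω₂
            (s' x.1.1 x.1.2 x.2.1 + x.2.2.2.1) (s' y.1.1 y.1.2 y.2.1 + y.2.2.2.1)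
          simp only [e, v] at *
          omega
        · have := finrank_range_blockMap_inf_add_le_of_lt hlt (hle₂ x.1.2) hω₂
            (s' y.1.1 y.1.2 y.2.1 + y.2.2.2.1) (s' x.1.1 x.1.2 x.2.1 + x.2.2.2.1)
          rw [inf_comm] at this
          simp only [e, v] at *
          omega
    · rcases Nat.lt_or_gt_of_ne (fun h => hi (Fin.ext h)) with hlt | hlt
      · have := finrank_range_blockMap_inf_add_le_of_lt hlt (hle₁ y.1.1) hω₁
          (s x.1.1 x.1.2 x.2.1 + x.2.2.1.1) (s y.1.1 y.1.2 y.2.1 + y.2.2.1.1)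
        simp only [e, v] at *
        omega
      · have := finrank_range_blockMap_inf_add_le_of_lt hlt (hle₁ x.1.1) hω₁
          (s y.1.1 y.1.2 y.2.1 + y.2.2.1.1) (s x.1.1 x.1.2 x.2.1 + x.2.2.1.1)
        rw [inf_comm] at this
        simp only [e, v] at *
        omega
  obtain ⟨S, hS1, hS2, hS3, hS4⟩ := exists_paired_family
    ((place F n 0 μ).coprod (place F n μ m))
    (coprod_place_injective (by omega) hn.le (Or.inl (by omega))) (window F n 0 μ)
    (window_coprod_place_fst (by omega) (Or.inl (by omega))) hδ e v he hv hev
    (by simpa using hc) C hC hCr K₁ K₂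
    (fun y => by simpa using hK₁ y) (fun y => by simpa using hK₂ y)
  refine ⟨S, ?_, hS2, hS3, hS4⟩
  have hfinG : ∀ i, Finite (G i δ) := fun i => by
    have : Finite ((Fin ω₁ → F) →ₗ[F] (Fin (μ - ω₁ - i * δ) → F)) := Module.finite_of_finite F
    infer_instance
  have hfinH : ∀ j, Finite (H j δ) := fun j => by
    have : Finite ((Fin ω₂ → F) →ₗ[F] (Fin (m - ω₂ - j * δ) → F)) := Module.finite_of_finite F
    infer_instance
  rw [hS1, Nat.card_sigma, Fintype.sum_prod_type, Finset.sum_range]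
  congr 1
  refine Finset.sum_congr rfl fun i _ => ?_
  rw [Finset.sum_range]
  refine Finset.sum_congr rfl fun j _ => ?_
  have h1 := hμi i (Nat.lt_succ_iff.1 i.2)
  have h2 := hmj j (Nat.lt_succ_iff.1 j.2)
  rw [Nat.card_prod, Nat.card_prod, Nat.card_eq_fintype_card (α := Fin _), Fintype.card_fin,
    hGc i δ hδ (by omega), hHc j δ hδ (by omega)]

end Assembly

/-! ### The three families and their union. -/

theorem mainTheorem3 (F : Type*) [Field F] [Fintype F] (q : ℕ) (hq : Fintype.card F = q)
    (n n₁ n₂ n₃ k δ : ℕ) (hn : n = n₁ + n₂) (hk : 2 * δ ≤ k) (hn₁ : k ≤ n₁) (hn₂ : k ≤ n₂)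
    (hn₃ : 0 < n₃)
    (T₁ T₂ : Finset ℕ) (hT₁ : T₁.Nonempty) (hT₂ : T₂.Nonempty)
    (hT₁sub : T₁ ⊆ Finset.Icc δ k) (hl₁ : minGap T₁ < 2 * δ)
    (hT₂sub : T₂ ⊆ Finset.Icc (k + δ - T₁.min' hT₁) k) (hl₂ : minGap T₂ < 2 * δ)
    (hcompat : (n₁ : ℤ) + k - T₁.min' hT₁ ≤ (n : ℤ) - n₃ + T₂.min' hT₂ - k)
    (μ₁ μ₂ μ₃ ω₁ ω₂ θ₁ θ₂ : ℕ)
    (hμ₁ : μ₁ = n₁ + k - T₁.min' hT₁)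
    (hμ₂ : μ₂ = n₃ + k - T₂.min' hT₂)
    (hμ₃ : μ₃ = n - μ₁ - μ₂)
    (hω₁ : ω₁ = if μ₁ > μ₂ then k - δ else δ)
    (hω₂ : ω₂ = k - ω₁)
    (hθ₁ : θ₁ = (μ₁ - ω₁) / δ - 1)
    (hθ₂ : θ₂ = min ((μ₂ - ω₂) / δ) ((μ₂ + μ₃ - ω₂) / δ - 1))
    (Λ₁ Γ₁ Λ₃ Γ₃ : ℕ → ℕ) (d₁ d₂ : ℕ → ℕ → ℕ)
    (hΛ₁ : ∀ i ≤ θ₁, Λ₁ i = max ω₁ (μ₁ - ω₁ - i * δ))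
    (hΓ₁ : ∀ i ≤ θ₁, Γ₁ i = min ω₁ (μ₁ - ω₁ - i * δ))
    (hΛ₃ : ∀ j ≤ θ₂, Λ₃ j = max ω₂ (μ₂ + μ₃ - ω₂ - j * δ))
    (hΓ₃ : ∀ j ≤ θ₂, Γ₃ j = min ω₂ (μ₂ + μ₃ - ω₂ - j * δ))
    (hd₁ : ∀ i ≤ θ₁, ∀ j ≤ θ₂,
      d₁ i j = if Λ₁ i ≥ Λ₃ j then ⌈(δ : ℚ) / 2⌉₊ else ⌊(δ : ℚ) / 2⌋₊)
    (hd₂ : ∀ i ≤ θ₁, ∀ j ≤ θ₂, d₂ i j = δ - d₁ i j)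
    (X₁ : Set (Submodule F (Fin n₁ → F))) (hX₁ : IsMDDC (2 * δ) (2 * δ - minGap T₁) T₁ X₁)
    (X₃ : Set (Submodule F (Fin n₃ → F))) (hX₃ : IsMDDC (2 * δ) (2 * δ - minGap T₂) T₂ X₃) :
    (maxCDCSize F n (2 * δ) k : ℚ) ≥
      (∑ t ∈ T₁, (dimDistr X₁ t : ℚ) * (mrdSize q k (n₂ + t - k) δ : ℚ)) +
      (∑ s ∈ T₂, (dimDistr X₃ s : ℚ) * rrmcSize q k (n - n₃ + s - k) δ (k - δ)) +
      rrmcSize q ω₁ (n₂ + T₁.min' hT₁ + ω₁ - 2 * k) δ (ω₁ - δ) *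
        ∑ i ∈ Finset.range (θ₁ + 1), ∑ j ∈ Finset.range (θ₂ + 1),
          (q : ℚ) ^ (min (Λ₁ i * d₂ i j) (Λ₃ j * d₁ i j) +
            Λ₁ i * (Γ₁ i + 1 - δ) + Λ₃ j * (Γ₃ j + 1 - δ)) := by
  have hδ : 0 < δ := by omega
  have hT₁k : ∀ t ∈ T₁, δ ≤ t ∧ t ≤ k := fun t ht => Finset.mem_Icc.1 (hT₁sub ht)
  have hT₂k : ∀ s ∈ T₂, s ≤ k := fun s hs => (Finset.mem_Icc.1 (hT₂sub hs)).2
  have hτ₁le : ∀ t ∈ T₁, T₁.min' hT₁ ≤ t := fun t ht => Finset.min'_le _ _ ht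
  have hτ₂le : ∀ s ∈ T₂, T₂.min' hT₂ ≤ s := fun s hs => Finset.min'_le _ _ hs
  have hτ₁mem := Finset.min'_mem T₁ hT₁
  have hτ₂mem := Finset.min'_mem T₂ hT₂
  generalize T₁.min' hT₁ = τ₁ at *
  generalize T₂.min' hT₂ = τ₂ at *
  have hτ₁ := hT₁k τ₁ hτ₁mem
  have hτ₂ := hT₂k τ₂ hτ₂mem
  -- A codeword of dimension `τ₂` exists in `X₃`, which bounds `τ₂` by the ambient dimension and
  -- yields `k ≤ μ₂`.
  have hτ₂n₃ : τ₂ ≤ n₃ := by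
    have h1 := hX₃.2.2.2.2.1 τ₂ hτ₂mem
    obtain ⟨U, -, hU⟩ := Set.nonempty_of_ncard_ne_zero h1.ne'
    have h2 := Submodule.finrank_le U
    rwa [hU, Module.finrank_fin_fun] at h2
  have hω : δ ≤ ω₁ ∧ δ ≤ ω₂ ∧ ω₁ + ω₂ = k := by
    split_ifs at hω₁ <;> omega
  obtain ⟨hω₁δ, hω₂δ, hωk⟩ := hω
  have hμ : μ₁ + μ₂ ≤ n := by omega
  have hkμ₁ : k ≤ μ₁ := by omega
  have hkμ₂ : k ≤ μ₂ := by omega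
  have hrest : μ₂ + μ₃ = n - μ₁ := by omega
  rw [hrest] at hθ₂ hΛ₃ hΓ₃
  -- The `- 1` in `θ₁` leaves at least `δ` columns to the right of the identity even at the largest
  -- offset, so that MRD codes of distance `δ` exist there.
  have hθ₁le : θ₁ * δ + δ + ω₁ ≤ μ₁ := by
    have h1 : 1 ≤ (μ₁ - ω₁) / δ := (Nat.one_le_div_iff hδ).2 (by omega)
    have h2 := Nat.div_mul_le_self (μ₁ - ω₁) δ
    have h3 : (θ₁ + 1) * δ = (μ₁ - ω₁) / δ * δ := by rw [hθ₁, Nat.sub_add_cancel h1]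
    rw [Nat.succ_mul] at h3
    omega
  have hθ₂le : θ₂ * δ + δ + ω₂ ≤ n - μ₁ := by
    have h1 : 1 ≤ (n - μ₁ - ω₂) / δ := (Nat.one_le_div_iff hδ).2 (by omega)
    have h2 := Nat.div_mul_le_self (n - μ₁ - ω₂) δ
    have h3 : (θ₂ + 1) * δ ≤ (n - μ₁ - ω₂) / δ * δ := Nat.mul_le_mul_right δ (by omega)
    rw [Nat.succ_mul] at h3
    omega
  have hdδ : ∀ i ≤ θ₁, ∀ j ≤ θ₂, d₁ i j ≤ δ := by
    intro i hi j hj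
    have h1 : (δ : ℚ) / 2 ≤ δ := half_le_self (Nat.cast_nonneg δ)
    rw [hd₁ i hi j hj]
    split_ifs
    · exact Nat.ceil_le.2 h1
    · exact Nat.floor_le_of_le h1
  -- coordinate subspaces separating the parts of the code
  let K₁ : Submodule F (Fin n → F) := LinearMap.ker (window F n 0 μ₁)
  let K₂ : Submodule F (Fin n → F) := LinearMap.ker (window F n (n - μ₂) μ₂)
  -- words lifted from `X₁`
  choose G _ hGc hGr using fun t => exists_mrd F k (n₂ + t - k)
  obtain ⟨S₁, hS₁c, hS₁d, hS₁p, hS₁w⟩ := exists_lifted_family (fun t ht => (hT₁k t ht).2) hl₁ hX₁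
    (fun t => n₂ + t - k)
    (fun t => placeThree F n 0 n₁ n₁ (k - t) (n₁ + (k - t)) (n₂ + t - k))
    (fun t ht => by
      have := hT₁k t ht
      apply placeThree_injective <;> omega)
    (window F n 0 n₁)
    (fun t ht p => by
      have := hT₁k t ht
      apply window_placeThree_one <;> omega)
    (fun t => (G t δ : Set _))
    (fun t _ M hM M' hM' hne => hGr t δ _ ((G t δ).sub_mem hM hM') (sub_ne_zero.2 hne))
  -- The coordinates of `U` and the identity block end at `n₁ + (k - t) ≤ μ₁`, because `t ≥ τ₁`; a
  -- vector vanishing there is zero.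
  have hS₁K : ∀ W ∈ S₁, W ⊓ K₁ = ⊥ := by
    intro W hW
    obtain ⟨t, ht, g, M, -, hg, rfl⟩ := hS₁w W hW
    have h1 := hT₁k t ht
    have h2 := hτ₁le t ht
    refine liftWord_inf_eq_bot M hg fun p hp => ?_
    have h3 := window_eq_zero_of_window_eq_zero (a := 0) (b := n₁) hp le_rfl (by omega)
    have h4 := window_eq_zero_of_window_eq_zero (a := n₁) (b := k - t) hp (by omega) (by omega)
    rw [window_placeThree_one (by omega) (by omega) (by omega)] at h3
    rw [window_placeThree_two (by omega) (by omega) (by omega)] at h4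
    exact Prod.ext h3 h4
  -- words lifted from `X₃`
  have hR : ∀ s, ∃ C : Set ((Fin k → F) →ₗ[F] (Fin (n - n₃ + s - k) → F)), s ∈ T₂ →
      (Nat.card C : ℚ) = rrmcSize (Fintype.card F) k (n - n₃ + s - k) δ (k - δ) ∧
      (∀ M ∈ C, ∀ M' ∈ C, M ≠ M' → δ ≤ Module.finrank F (LinearMap.range (M - M'))) ∧
      ∀ M ∈ C, Module.finrank F (LinearMap.range M) ≤ k - δ := by
    intro s
    by_cases hs : s ∈ T₂
    · have h1 := hT₂k s hs
      have h2 := hτ₂le s hs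
      obtain ⟨C, hC⟩ := exists_rank_restricted_code F (a := k) (b := n - n₃ + s - k) (δ := δ)
        (r := k - δ) (by omega) hδ (by omega) (by omega)
      exact ⟨C, fun _ => hC⟩
    · exact ⟨∅, fun h => absurd h hs⟩
  choose R hR using hR
  obtain ⟨S₂, hS₂c, hS₂d, hS₂p, hS₂w⟩ := exists_lifted_family hT₂k hl₂ hX₃
    (fun s => n - n₃ + s - k)
    (fun s => placeThree F n (n - n₃) n₃ (n - n₃ + s - k) (k - s) 0 (n - n₃ + s - k))
    (fun s hs => by
      have := hT₂k s hs
      have := hτ₂le s hs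
      apply placeThree_injective <;> omega)
    (window F n (n - n₃) n₃)
    (fun s hs p => by
      have := hT₂k s hs
      have := hτ₂le s hs
      apply window_placeThree_one <;> omega)
    R (fun s hs => (hR s hs).2.1)
  have hS₂K₂ : ∀ W ∈ S₂, W ⊓ K₂ = ⊥ := by
    intro W hW
    obtain ⟨s, hs, g, M, -, hg, rfl⟩ := hS₂w W hW
    have h1 := hT₂k s hs
    have h2 := hτ₂le s hs
    refine liftWord_inf_eq_bot M hg fun p hp => ?_
    have h3 := window_eq_zero_of_window_eq_zero (a := n - n₃) (b := n₃) hp (by omega) (by omega)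
    have h4 := window_eq_zero_of_window_eq_zero (a := n - n₃ + s - k) (b := k - s) hp
      (by omega) (by omega)
    rw [window_placeThree_one (by omega) (by omega) (by omega)] at h3
    rw [window_placeThree_two (by omega) (by omega) (by omega)] at h4
    exact Prod.ext h3 h4
  -- The `M`-part occupies the first `n - n₃ + s - k ≥ n - μ₂ ≥ μ₁` coordinates, so the lift of `ker
  -- M` vanishes on the first `μ₁`.
  have hS₂K₁ : ∀ W ∈ S₂, δ ≤ Module.finrank F (W ⊓ K₁ : Submodule F (Fin n → F)) := by
    intro W hW
    obtain ⟨s, hs, g, M, hM, hg, rfl⟩ := hS₂w W hW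
    have h1 := hT₂k s hs
    have h2 := hτ₂le s hs
    have h3 := (hR s hs).2.2 M hM
    refine le_finrank_liftWord_inf ?_ hg (fun p => ?_) (by rw [Module.finrank_fin_fun]; omega)
    · apply placeThree_injective <;> omega
    · rw [LinearMap.mem_ker, placeThree_apply, map_add, map_add,
        window_place_of_disjoint (by omega), window_place_of_disjoint (by omega), map_zero,
        map_zero, add_zero, add_zero]
  -- words built from blocks
  obtain ⟨C, hCc, hCd, hCr⟩ := exists_rank_restricted_code F (a := ω₁)
    (b := n₂ + τ₁ + ω₁ - 2 * k) (δ := δ) (r := ω₁ - δ) (by omega) hδ hω₁δ (by omega)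
  -- Since `n - μ₁ = n₂ + τ₁ - k`, the column number `n₂ + τ₁ + ω₁ - 2 * k` is `(n - μ₁) - ω₂`, the
  -- full size of a complement of an `ω₂`-dimensional subspace.
  obtain ⟨S₃, hS₃c, hS₃d, hS₃p, hS₃K⟩ := exists_block_family (n := n) (μ := μ₁) (m := n - μ₁)
    (by omega) hδ hω₁δ hω₂δ hθ₁le hθ₂le d₁ hdδ (by omega) C hCd
    (fun M hM => by have := hCr M hM; omega) K₁ K₂
    (fun y => window_place_of_disjoint (by omega) y)
    (fun y => window_place_of_disjoint (by omega) y)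
  rw [hωk] at hS₃d hS₃p
  -- the union of the three families
  have hcross : ∀ {A B : Set (Submodule F (Fin n → F))}, (∀ W ∈ B, Module.finrank F W = k) →
      ∀ K : Submodule F (Fin n → F), (∀ W ∈ A, W ⊓ K = ⊥) →
      (∀ W ∈ B, δ ≤ Module.finrank F (W ⊓ K : Submodule F (Fin n → F))) →
      ∀ W ∈ A, ∀ W' ∈ B, Module.finrank F (W ⊓ W' : Submodule F (Fin n → F)) + δ ≤ k := by
    intro A B hB K hA hBK W hW W' hW'
    have := finrank_inf_add_le_of_inf_eq_bot (hA W hW) (hBK W' hW')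
    rwa [hB W' hW'] at this
  have h₁₂ := hcross hS₂d K₁ hS₁K hS₂K₁
  have h₁₃ := hcross hS₃d K₁ hS₁K fun W hW => hω₂δ.trans (hS₃K W hW).1
  have h₂₃ := hcross hS₃d K₂ hS₂K₂ fun W hW => (hS₃K W hW).2
  have hdisj : ∀ {A B : Set (Submodule F (Fin n → F))}, (∀ W ∈ B, Module.finrank F W = k) →
      (∀ W ∈ A, ∀ W' ∈ B, Module.finrank F (W ⊓ W' : Submodule F (Fin n → F)) + δ ≤ k) →
      Disjoint A B := by
    intro A B hB hAB
    refine Set.disjoint_left.2 fun W hA hW => ?_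
    have := hAB W hA W hW
    rw [inf_idem, hB W hW] at this
    omega
  have hfin : Finite (Submodule F (Fin n → F)) :=
    Finite.of_injective (fun U : Submodule F (Fin n → F) => (U : Set (Fin n → F)))
      SetLike.coe_injective
  have hcard : ((S₁ ∪ S₂) ∪ S₃).ncard = S₁.ncard + S₂.ncard + S₃.ncard := by
    rw [Set.ncard_union_eq (Set.disjoint_union_left.2 ⟨hdisj hS₃d h₁₃, hdisj hS₃d h₂₃⟩),
      Set.ncard_union_eq (hdisj hS₂d h₁₂)]
  have hmain : ((S₁ ∪ S₂) ∪ S₃).ncard ≤ maxCDCSize F n (2 * δ) k := by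
    refine ncard_le_maxCDCSize (by omega) ?_ ?_
    · rintro W ((hW | hW) | hW)
      · exact hS₁d W hW
      · exact hS₂d W hW
      · exact hS₃d W hW
    · rintro W ((hW | hW) | hW) W' ((hW' | hW') | hW') hne
      · exact hS₁p W hW W' hW' hne
      · exact h₁₂ W hW W' hW'
      · exact h₁₃ W hW W' hW'
      · exact inf_comm W W' ▸ h₁₂ W' hW' W hW
      · exact hS₂p W hW W' hW' hne
      · exact h₂₃ W hW W' hW'
      · exact inf_comm W W' ▸ h₁₃ W' hW' W hW
      · exact inf_comm W W' ▸ h₂₃ W' hW' W hW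
      · exact hS₃p W hW W' hW' hne
  -- the cardinalities
  subst hq
  have hc₁ : (S₁.ncard : ℚ) = ∑ t ∈ T₁,
      (dimDistr X₁ t : ℚ) * (mrdSize (Fintype.card F) k (n₂ + t - k) δ : ℚ) := by
    rw [hS₁c, Nat.cast_sum]
    refine Finset.sum_congr rfl fun t ht => ?_
    have := hT₁k t ht
    rw [Nat.cast_mul, ← hGc t δ hδ (by omega)]
    rfl
  have hc₂ : (S₂.ncard : ℚ) = ∑ s ∈ T₂,
      (dimDistr X₃ s : ℚ) * rrmcSize (Fintype.card F) k (n - n₃ + s - k) δ (k - δ) := by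
    rw [hS₂c, Nat.cast_sum]
    refine Finset.sum_congr rfl fun s hs => ?_
    rw [Nat.cast_mul, (hR s hs).1]
  have hc₃ : (S₃.ncard : ℚ) =
      rrmcSize (Fintype.card F) ω₁ (n₂ + τ₁ + ω₁ - 2 * k) δ (ω₁ - δ) *
        ∑ i ∈ Finset.range (θ₁ + 1), ∑ j ∈ Finset.range (θ₂ + 1),
          (Fintype.card F : ℚ) ^ (min (Λ₁ i * d₂ i j) (Λ₃ j * d₁ i j) +
            Λ₁ i * (Γ₁ i + 1 - δ) + Λ₃ j * (Γ₃ j + 1 - δ)) := by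
    rw [hS₃c, Nat.cast_mul, hCc, mul_comm, Nat.cast_sum]
    congr 1
    refine Finset.sum_congr rfl fun i hi => ?_
    rw [Nat.cast_sum]
    refine Finset.sum_congr rfl fun j hj => ?_
    have hi' : i ≤ θ₁ := Nat.lt_succ_iff.1 (Finset.mem_range.1 hi)
    have hj' : j ≤ θ₂ := Nat.lt_succ_iff.1 (Finset.mem_range.1 hj)
    rw [hd₂ i hi' j hj', hΛ₁ i hi', hΓ₁ i hi', hΛ₃ j hj', hΓ₃ j hj', mrdSize, mrdSize, ← pow_add,
      ← pow_add, Nat.cast_pow, add_assoc]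
  rw [ge_iff_le, ← hc₁, ← hc₂, ← hc₃]
  exact_mod_cast hcard ▸ hmain
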